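/- **Setting.** Fix constants $a_\phi,l_\phi,\phi^*>0$. For every sample size $n$ let $X$ be an $n\times p$ real matrix; a model $M_k$ is given by a set $k$ of $p_k\le\bar p$ columns of $X$, which form the matrix $X_k$, and $X_k'X_k$ is invertible whenever $p_k\le\bar p$. All models have positive prior probabilities $p(M_k)$ summing to one, where $p(M_k)$ depends on $k$ only through $p_k$; put $r_{p_k,p_l}=p(M_k)/p(M_l)$. Under $M_k$, $$\mathbf y\mid\boldsymbol\theta_k,\phi\sim N(X_k\boldsymbol\theta_k,\phi I),\qquad \boldsymbol\theta_k\mid\phi\sim N(\mathbf 0,\tau\phi V_k),\qquad \phi\sim \mathrm{IG}(a_\phi/2,l_\phi/2),$$ with $\tau>0$ and $V_k$ symmetric positive definite, and $p(M_k\mid\mathbf y)\propto p(\mathbf y\mid M_k)\,p(M_k)$ is the posterior probability, normalized over all models with $p_k\le\bar p$. The data are generated by $f^*(\mathbf y)=N(\mathbf y;X_t\boldsymbol\theta^*_t,\phi^*I)$ for a model $M_t$. The quantities $X,p,\bar p,\tau,V_k,t,\boldsymbol\theta_t^*$, the model prior and the model $m$ below may all depend on $n$. For positive $b_n$, $a_n\ll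 b_n$ means $a_n/b_n\to0$ as $n\to\infty$, and $a_n\asymp b_n$ means that $a_n/b_n$ is bounded away from $0$ and $\infty$ for large $n$. Let $S$ be the set of spurious models ($t\subsetneq m$, $p_m\le\bar p$) and $S^c$ the set of non-spurious models ($t\not\subseteq m$, $p_m\le\bar p$). Let $\rho_{k1}\ge\dots\ge\rho_{kp_k}>0$ be the eigenvalues of $V_kX_k'X_k$, and $$\lambda_{tm}=(X_t\boldsymbol\theta_t^*)'\bigl(I-X_m(X_m'X_m)^{-1}X_m'\bigr)X_t\boldsymbol\theta_t^*/\phi^*,\qquad \lambda_{t0}=(X_t\boldsymbol\theta_t^*)'X_t\boldsymbol\theta_t^*/\phi^*.$$ **Conditions.** - (B1) $\bar p\ll\min\{n,p\}$ and $\tau\gg\bar p$. - (B2) For some constant $\beta_1\in(0,1)$, $\lambda_{tm}^{\beta_1}\gg p_q$ with $M_q=M_t\cup M_m$, uniformly over $m\in S^c$. - (C1), for $m\in S$: $\tau\to\infty$, and $r_{p_m,p_t}\ll\tau^{\beta_2(p_m-p_t)/2}$ for some fixed $\beta_2\in(0,1)$. - (C2), for $m\in S^c$: for every fixed $\beta_3\in(0,1)$,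 $b_n=\lambda_{tm}^{\beta_3}+(p_m-p_t)\log(1+\tau)$ is positive for all large $n$, and $\limsup_{n\to\infty}\log(r_{p_m,p_t})/b_n\le0$. - (D1), for the model $m$: $\prod_{j=1}^{p_m}(\tau\rho_{mj}+1)^{1/2}\big/\prod_{j=1}^{p_t}(\tau\rho_{tj}+1)^{1/2}\asymp(c_{mt}\tau)^{(p_m-p_t)/2}$ for some constant $c_{mt}>0$. - (D2) $\lambda_{t0}\ll\tau\rho_{tp_t}$ (required when $p_t\ge1$). **Proposition.** Assume (B1), (B2) and (D2). (i) Let $m\in S$ satisfy (C1) and (D1). Then for all fixed $\alpha\in(0,1)$ and $\kappa>0$, $$E_{f^*}(p(M_m\mid\mathbf y))\ll\max\left\{r_{p_m,p_t}^{\alpha}\,\tau^{\alpha(p_t-p_m)/2},\;e^{-\kappa n},\;e^{-\tau\rho_{tp_t}/2}\right\},$$ where the last term is absent when $p_t=0$. (ii) Let $m\in S^c$ satisfy (C2) and (D1), and suppose that $\lambda_{tm}$ grows at most polynomially in $n$, i.e. $\lambda_{tm}=O(n^K)$ for some fixed $K$. Then for all fixed $\gamma,\alpha\in(0,1)$ and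 $\kappa>0$, $$E_{f^*}(p(M_m\mid\mathbf y))\ll\exp\left\{-\min\left\{\gamma\lambda_{tm}^{\alpha}/2,\;\kappa n,\;\tau\rho_{tp_t}/2\right\}\right\}.$$ -/

import Mathlib

open MeasureTheory ProbabilityTheory Filter Asymptotics Set
open scoped Matrix ENNReal

noncomputable section

namespace BMS

/-- The density at `x` of the multivariate normal distribution with mean `μ` and (positive
definite) covariance matrix `C`. -/
def normalPdf {ι : Type} [Fintype ι] [DecidableEq ι] (μ : ι → ℝ) (C : Matrix ι ι ℝ)
    (x : ι → ℝ) : ℝ :=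
  (Real.sqrt ((2 * Real.pi) ^ Fintype.card ι * C.det))⁻¹ *
    Real.exp (-((x - μ) ⬝ᵥ (C⁻¹ *ᵥ (x - μ))) / 2)

/-- The density at `x > 0` of the inverse gamma distribution with shape `a` and scale `b`. -/
def invGammaPdf (a b x : ℝ) : ℝ :=
  b ^ a / Real.Gamma a * x ^ (-(a + 1)) * Real.exp (-b / x)

/-- The matrix `X_k` of the columns of `X` selected by the model `k`. -/
def cols {n p : ℕ} (X : Matrix (Fin n) (Fin p) ℝ) (k : Finset (Fin p)) :
    Matrix (Fin n) k ℝ :=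
  X.submatrix id (fun j => (j : Fin p))

/-- The Gram matrix `X_k' X_k`. -/
def gram {n p : ℕ} (X : Matrix (Fin n) (Fin p) ℝ) (k : Finset (Fin p)) : Matrix k k ℝ :=
  (cols X k)ᵀ * cols X k

/-- A Bayesian variable selection problem with sample size `n`. A model is a set `k` of at
most `pbar` columns of `X`. -/
structure Problem (n : ℕ) where
  /-- number of variables -/
  p : ℕ
  /-- design matrix -/
  X : Matrix (Fin n) (Fin p) ℝ
  /-- maximum model size -/
  pbar : ℕ
  gram_isUnit : ∀ k : Finset (Fin p), k.card ≤ pbar → IsUnit (gram X k).det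
  /-- `prior l` is the prior probability of each single model with `l` variables -/
  prior : ℕ → ℝ
  prior_pos : ∀ k : Finset (Fin p), k.card ≤ pbar → 0 < prior k.card
  prior_sum : ∑ k : Finset (Fin p) with k.card ≤ pbar, prior k.card = 1
  /-- prior dispersion -/
  tau : ℝ
  tau_pos : 0 < tau
  /-- the prior covariance of the coefficients under model `k` is `tau * φ * V k` -/
  V : (k : Finset (Fin p)) → Matrix k k ℝ
  V_posDef : ∀ k : Finset (Fin p), k.card ≤ pbar → (V k).PosDef
  /-- the true model -/
  t : Finset (Fin p)
  t_card : t.card ≤ pbar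
  /-- the true regression coefficients -/
  theta : t → ℝ

namespace Problem

variable {n : ℕ} (D : Problem n)

/-- The mean `X_t θ_t` of the data-generating distribution. -/
def mean : Fin n → ℝ := cols D.X D.t *ᵥ D.theta

/-- The data-generating distribution `N(X_t θ_t, φ I)`. -/
def truth (φ : ℝ) : Measure (Fin n → ℝ) :=
  Measure.pi fun i => gaussianReal (D.mean i) φ.toNNReal

/-- The integrated likelihood `p(y | M_k)` under `y ~ N(X_k θ, φ I)`, `θ | φ ~ N(0, τ φ V_k)` and
`φ ~ IG(a / 2, l / 2)`. -/
def evidence (a l : ℝ) (k : Finset (Fin D.p)) (y : Fin n → ℝ) : ℝ≥0∞ :=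
  ∫⁻ φ in Ioi (0 : ℝ), ∫⁻ θ : k → ℝ, ENNReal.ofReal
    (normalPdf (cols D.X k *ᵥ θ) (φ • (1 : Matrix (Fin n) (Fin n) ℝ)) y *
      normalPdf 0 ((D.tau * φ) • D.V k) θ * invGammaPdf (a / 2) (l / 2) φ)

/-- The posterior probability `p(M_m | y)`. -/
def posterior (a l : ℝ) (m : Finset (Fin D.p)) (y : Fin n → ℝ) : ℝ :=
  (D.evidence a l m y * ENNReal.ofReal (D.prior m.card) /
    ∑ k : Finset (Fin D.p) with k.card ≤ D.pbar,
      D.evidence a l k y * ENNReal.ofReal (D.prior k.card)).toReal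

/-- The expectation of `p(M_m | y)` under the data-generating distribution. -/
def meanPosterior (a l φ : ℝ) (m : Finset (Fin D.p)) : ℝ :=
  ∫ y, D.posterior a l m y ∂(D.truth φ)

/-- `m` is a spurious model: it strictly contains the true model. -/
def Spurious (m : Finset (Fin D.p)) : Prop := D.t ⊂ m ∧ m.card ≤ D.pbar

/-- `m` is a non-spurious model: it does not contain the true model. -/
def NonSpurious (m : Finset (Fin D.p)) : Prop := ¬ D.t ⊆ m ∧ m.card ≤ D.pbar

/-- The prior odds `p(M_m) / p(M_t)`. -/
def odds (m : Finset (Fin D.p)) : ℝ := D.prior m.card / D.prior D.t.card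

/-- `p_m - p_t`, which may be negative. -/
def sizeDiff (m : Finset (Fin D.p)) : ℝ := (m.card : ℝ) - (D.t.card : ℝ)

/-- The non-centrality parameter
`(X_t θ_t)' (I - X_m (X_m' X_m)⁻¹ X_m') X_t θ_t / φ`; for `m = ∅` this is
`(X_t θ_t)' X_t θ_t / φ`. -/
def lam (φ : ℝ) (m : Finset (Fin D.p)) : ℝ :=
  (D.mean ⬝ᵥ ((1 - cols D.X m * (gram D.X m)⁻¹ * (cols D.X m)ᵀ) *ᵥ D.mean)) / φ

/-- The eigenvalues of `V_k X_k' X_k`, with multiplicities. -/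
def rho (k : Finset (Fin D.p)) : Multiset ℝ := (D.V k * gram D.X k).charpoly.roots

/-- The smallest eigenvalue of `V_t X_t' X_t`. It is only meaningful for `t ≠ ∅`. -/
def rhoMin : ℝ := sInf {x | x ∈ D.rho D.t}

/-- `∏ j, (τ ρ_{kj} + 1) ^ (1 / 2)`. -/
def rhoProd (k : Finset (Fin D.p)) : ℝ :=
  ((D.rho k).map fun x => (D.tau * x + 1) ^ (1 / 2 : ℝ)).prod

/-- `exp (-τ ρ_{t p_t} / 2)`, where the smallest element of the empty list of eigenvalues of the
model without variables counts as `+∞`. -/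
def rhoTail : ℝ := if D.t = ∅ then 0 else Real.exp (-(D.tau * D.rhoMin / 2))

end Problem

/-- `pbar ≪ min {n, p}` and `pbar ≪ τ`. -/
def CondB1 (D : (n : ℕ) → Problem n) : Prop :=
  ((fun n => ((D n).pbar : ℝ)) =o[atTop] fun n => min (n : ℝ) ((D n).p : ℝ)) ∧
    ((fun n => ((D n).pbar : ℝ)) =o[atTop] fun n => (D n).tau)

/-- `p_q ≪ λ_{tm} ^ β₁` with `q = t ∪ m`, for all non-spurious `m`. As `m` may change with `n`,
this says that the rate is uniform in `m`. -/
def CondB2 (φ : ℝ) (D : (n : ℕ) → Problem n) : Prop :=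
  ∃ β ∈ Ioo (0 : ℝ) 1, ∀ C > (0 : ℝ), ∀ᶠ n in atTop, ∀ m, (D n).NonSpurious m →
    C * (((D n).t ∪ m).card : ℝ) ≤ (D n).lam φ m ^ β

/-- `τ ≫ 1` and `r_{p_m,p_t} ≪ τ ^ (β₂ (p_m - p_t) / 2)`. -/
def CondC1 (D : (n : ℕ) → Problem n) (m : (n : ℕ) → Finset (Fin (D n).p)) : Prop :=
  Tendsto (fun n => (D n).tau) atTop atTop ∧
    ∃ β ∈ Ioo (0 : ℝ) 1, (fun n => (D n).odds (m n)) =o[atTop] fun n =>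
      (D n).tau ^ (β * (D n).sizeDiff (m n) / 2)

/-- `log r_{p_m,p_t} ≪ λ_{tm} ^ β₃ + (p_m - p_t) log (1 + τ)` for all `β₃ ∈ (0, 1)`: the right-hand
side is eventually positive, and the left-hand side (which may be negative, and then imposes
nothing) is eventually below every positive multiple of it. -/
def CondC2 (φ : ℝ) (D : (n : ℕ) → Problem n) (m : (n : ℕ) → Finset (Fin (D n).p)) : Prop :=
  ∀ β ∈ Ioo (0 : ℝ) 1,
    (∀ᶠ n in atTop,
      0 < (D n).lam φ (m n) ^ β + (D n).sizeDiff (m n) * Real.log (1 + (D n).tau)) ∧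
    ∀ ε > (0 : ℝ), ∀ᶠ n in atTop, Real.log ((D n).odds (m n)) ≤
      ε * ((D n).lam φ (m n) ^ β + (D n).sizeDiff (m n) * Real.log (1 + (D n).tau))

/-- `∏ j, (τ ρ_{mj} + 1) ^ (1 / 2) / ∏ j, (τ ρ_{tj} + 1) ^ (1 / 2) ≍ (c τ) ^ ((p_m - p_t) / 2)`
for a constant `c > 0`. -/
def CondD1 (D : (n : ℕ) → Problem n) (m : (n : ℕ) → Finset (Fin (D n).p)) : Prop :=
  ∃ c > (0 : ℝ), (fun n => (D n).rhoProd (m n) / (D n).rhoProd (D n).t) =Θ[atTop] fun n =>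
    (c * (D n).tau) ^ ((D n).sizeDiff (m n) / 2)

/-- `λ_{t0} ≪ τ ρ_{t p_t}` (void for `t = ∅`, where both sides are zero). -/
def CondD2 (φ : ℝ) (D : (n : ℕ) → Problem n) : Prop :=
  (fun n => (D n).lam φ ∅) =o[atTop] fun n => (D n).tau * (D n).rhoMin

/-- The signal strength `λ_{tm}` grows at most polynomially in `n`. -/
def PolySignal (φ : ℝ) (D : (n : ℕ) → Problem n) (m : (n : ℕ) → Finset (Fin (D n).p)) : Prop :=
  ∃ K : ℕ, (fun n => (D n).lam φ (m n)) =O[atTop] fun n => (n : ℝ) ^ K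

end BMS

end

/-! Conjugacy makes the evidence explicit: up to a factor common to all models it is `rhoProd k`⁻¹
`(l + fit k y)` to the power -(n+a)/2, where `fit` is a ridge residual sum of squares
(`exists_evidence_eq`). Keeping only the true model in the denominator bounds the posterior
probability by prior odds, times a ratio of `rhoProd`, times a power of a ratio of sums of squares.
Moreover `fit m` ≥ rss_m, while `fit t` exceeds rss_t by at most `shrinkage`, the squared length of
the projected data over τρ_{tp_t}. By (B2) and (D2), this excess is at most 10φ outside an event of
probability ≪ exp(-τρ_{tp_t}/2).

Spurious models. With noise ε, put R = rss_m(ε) and U = ε'(H_m - H_t)ε, where H_k is the orthogonal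
projection onto the columns of X_k; then rss_t = R + U. The power of 1 + U/(l+R) has exponent
(n+a)/2, too large for a finite mean. Since a probability p satisfies p ≤ p^s for s < 1, the
exponent can be lowered to s'ν/2 with s' < 1 and ν = n - p_m, the degrees of freedom of R.
`exists_envelope` dominates this power by a series of exponentials linear in U and R. Each has an
explicit Gaussian expectation, and the series sums to a constant depending on s' alone, times
(1-s')^{-(p_m-p_t)/2} (`meanPosterior_spurious_le`). The loss from s < 1 is paid for by (C1): with α
< s, a spare negative power of τ beats all constants. The term exp(-κn) covers the event that
rss_t(ε)/n is tiny.

Non-spurious models. Here rss_m(y) contains λ_{tm}φ. Outside three exponentially unlikely events it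
exceeds rss_t by at least 5λ_{tm}φ/8 while rss_t stays O(n), so the likelihood factor is at most (1
+ λ_{tm}/(c₂n))^{-n/2} (`meanPosterior_nonSpurious_le`). This decays exponentially in λ_{tm} for
weak signals and faster than exp(-κn) for strong ones (`exp_mul_one_add_rpow_le`). By (C2) and (D1),
odds and dimension penalty cost at most a multiple of exp(2λ_{tm}^b); polynomial growth allows b so
small that λ_{tm}^b is negligible against n. -/

noncomputable section

namespace BMS

/-! ### Gaussian integrals and moment generating functions -/

section Gaussian

variable {ι : Type} [Fintype ι]

theorem prod_gaussianPDF (μ x : ι → ℝ) {φ : ℝ} (hφ : 0 < φ) :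
    ∏ i, gaussianPDF (μ i) φ.toNNReal (x i) =
      ENNReal.ofReal ((√(2 * Real.pi * φ) ^ Fintype.card ι)⁻¹ *
        Real.exp (-((x - μ) ⬝ᵥ (x - μ)) / (2 * φ))) := by
  simp only [gaussianPDF]
  rw [← ENNReal.ofReal_prod_of_nonneg (fun i _ => gaussianPDFReal_nonneg _ _ _)]
  congr 1
  simp only [gaussianPDFReal, Finset.prod_mul_distrib, Finset.prod_const, Finset.card_univ,
    Real.coe_toNNReal _ hφ.le, inv_pow, ← Real.exp_sum, dotProduct, Pi.sub_apply]
  congr 2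
  rw [← Finset.sum_div, ← Finset.sum_neg_distrib]
  congr 1
  exact Finset.sum_congr rfl fun i _ => by ring

theorem pi_gaussianReal_eq_withDensity (μ : ι → ℝ) {φ : ℝ} (hφ : 0 < φ) :
    Measure.pi (fun i => gaussianReal (μ i) φ.toNNReal) =
      volume.withDensity fun x => ENNReal.ofReal ((√(2 * Real.pi * φ) ^ Fintype.card ι)⁻¹ *
        Real.exp (-((x - μ) ⬝ᵥ (x - μ)) / (2 * φ))) := by
  have hv : φ.toNNReal ≠ 0 := by simpa using hφ
  refine Measure.pi_eq fun s hs => ?_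
  simp only [← prod_gaussianPDF _ _ hφ]
  rw [withDensity_apply _ (MeasurableSet.univ_pi hs), volume_pi, Measure.restrict_pi_pi]
  simp only [gaussianPDF]
  simp only [← ENNReal.ofReal_prod_of_nonneg (fun i _ => gaussianPDFReal_nonneg _ _ _)]
  rw [← ofReal_integral_eq_lintegral_ofReal]
  · rw [integral_fintype_prod_eq_prod (f := fun i x => gaussianPDFReal (μ i) φ.toNNReal x),
      ENNReal.ofReal_prod_of_nonneg
        (fun i _ => integral_nonneg fun x => gaussianPDFReal_nonneg _ _ _)]
    refine Finset.prod_congr rfl fun i _ => ?_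
    rw [gaussianReal_apply _ hv, ofReal_integral_eq_lintegral_ofReal]
    · rfl
    · exact (integrable_gaussianPDFReal _ _).integrableOn
    · exact ae_of_all _ fun x => gaussianPDFReal_nonneg _ _ _
  · exact Integrable.fintype_prod (f := fun i x => gaussianPDFReal (μ i) φ.toNNReal x)
      fun i => (integrable_gaussianPDFReal _ _).integrableOn
  · exact ae_of_all _ fun x => Finset.prod_nonneg fun i _ => gaussianPDFReal_nonneg _ _ _

theorem lintegral_pi_gaussianReal (μ : ι → ℝ) {φ : ℝ} (hφ : 0 < φ) {F : (ι → ℝ) → ℝ≥0∞}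
    (hF : Measurable F) :
    ∫⁻ y, F y ∂(Measure.pi fun i => gaussianReal (μ i) φ.toNNReal) =
      ENNReal.ofReal (√(2 * Real.pi * φ) ^ Fintype.card ι)⁻¹ *
        ∫⁻ x : ι → ℝ, ENNReal.ofReal (Real.exp (-(x ⬝ᵥ x) / (2 * φ))) * F (x + μ) := by
  rw [pi_gaussianReal_eq_withDensity μ hφ, lintegral_withDensity_eq_lintegral_mul _ _ hF]
  · rw [← lintegral_add_right_eq_self _ μ, ← lintegral_const_mul]
    · refine lintegral_congr fun x => ?_
      rw [Pi.mul_apply, ENNReal.ofReal_mul (by positivity), add_sub_cancel_right, mul_assoc]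
    · simp only [dotProduct]
      fun_prop
  · simp only [dotProduct, Pi.sub_apply]
    fun_prop

theorem lintegral_exp_neg_dotProduct {φ : ℝ} (hφ : 0 < φ) :
    ∫⁻ x : ι → ℝ, ENNReal.ofReal (Real.exp (-(x ⬝ᵥ x) / (2 * φ))) =
      ENNReal.ofReal (√(2 * Real.pi * φ) ^ Fintype.card ι) := by
  have h := lintegral_pi_gaussianReal (0 : ι → ℝ) hφ (F := fun _ => 1) measurable_const
  have hpos : 0 < √(2 * Real.pi * φ) ^ Fintype.card ι := by positivity
  simp only [lintegral_const, measure_univ, mul_one] at h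
  rw [ENNReal.ofReal_inv_of_pos hpos] at h
  rw [← ENNReal.div_eq_one_iff (by rwa [Ne, ENNReal.ofReal_eq_zero, not_le]) (by simp),
    ENNReal.div_eq_inv_mul, ← h]

open scoped MatrixOrder in
theorem exists_isUnit_transpose_mul_self [DecidableEq ι] {A : Matrix ι ι ℝ} (hA : A.PosDef) :
    ∃ B : Matrix ι ι ℝ, B.det ≠ 0 ∧ A = Bᵀ * B := by
  obtain ⟨B, rfl⟩ := CStarAlgebra.nonneg_iff_eq_star_mul_self.1 hA.posSemidef.nonneg
  refine ⟨B, fun h => ?_, by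
    rw [Matrix.star_eq_conjTranspose, Matrix.conjTranspose_eq_transpose_of_trivial]⟩
  have := hA.det_pos
  rw [Matrix.det_mul, h, mul_zero] at this
  exact lt_irrefl _ this

/-- Writing A = BᵀB, the substitution x ↦ Bx reduces the integral to the spherical case with
Jacobian |det B| = √(det A). -/
theorem lintegral_exp_neg_posDef [DecidableEq ι] {A : Matrix ι ι ℝ} (hA : A.PosDef) {φ : ℝ}
    (hφ : 0 < φ) :
    ∫⁻ x : ι → ℝ, ENNReal.ofReal (Real.exp (-(x ⬝ᵥ (A *ᵥ x)) / (2 * φ))) =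
      ENNReal.ofReal (√(2 * Real.pi * φ) ^ Fintype.card ι * (√A.det)⁻¹) := by
  obtain ⟨B, hB, rfl⟩ := exists_isUnit_transpose_mul_self hA
  have hmeas : Measurable (Matrix.toLin' B) := (LinearMap.continuous_on_pi _).measurable
  have h := lintegral_map (μ := volume)
    (f := fun x : ι → ℝ => ENNReal.ofReal (Real.exp (-(x ⬝ᵥ x) / (2 * φ))))
    (by simp only [dotProduct]; fun_prop) hmeas
  rw [Real.map_matrix_volume_pi_eq_smul_volume_pi hB, lintegral_smul_measure,
    lintegral_exp_neg_dotProduct hφ, smul_eq_mul] at h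
  have e : √(Bᵀ * B).det = |B.det| := by
    rw [Matrix.det_mul, Matrix.det_transpose, ← sq, Real.sqrt_sq_eq_abs]
  rw [e, mul_comm (√(2 * Real.pi * φ) ^ _), ENNReal.ofReal_mul (by positivity), ← abs_inv, h]
  refine lintegral_congr fun x => ?_
  rw [Matrix.toLin'_apply, ← Matrix.mulVec_mulVec, Matrix.dotProduct_mulVec,
    Matrix.vecMul_transpose]

/-- The moment generating function of a quadratic form in a Gaussian vector. -/
theorem lintegral_exp_quadratic [DecidableEq ι] (μ : ι → ℝ) {φ : ℝ} (hφ : 0 < φ) {M : Matrix ι ι ℝ}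
    (hM : (1 - M).PosDef) :
    ∫⁻ y, ENNReal.ofReal (Real.exp (((y - μ) ⬝ᵥ (M *ᵥ (y - μ))) / (2 * φ)))
        ∂(Measure.pi fun i => gaussianReal (μ i) φ.toNNReal) =
      ENNReal.ofReal (√(1 - M).det)⁻¹ := by
  have hpos : 0 < √(2 * Real.pi * φ) ^ Fintype.card ι := by positivity
  rw [lintegral_pi_gaussianReal μ hφ]
  · have : ∀ x : ι → ℝ, ENNReal.ofReal (Real.exp (-(x ⬝ᵥ x) / (2 * φ))) *
        ENNReal.ofReal (Real.exp (((x + μ - μ) ⬝ᵥ (M *ᵥ (x + μ - μ))) / (2 * φ))) =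
        ENNReal.ofReal (Real.exp (-(x ⬝ᵥ ((1 - M) *ᵥ x)) / (2 * φ))) := by
      intro x
      rw [← ENNReal.ofReal_mul (by positivity), ← Real.exp_add, add_sub_cancel_right,
        Matrix.sub_mulVec, Matrix.one_mulVec, dotProduct_sub]
      congr 2
      ring
    simp only [this]
    rw [lintegral_exp_neg_posDef hM hφ, ← ENNReal.ofReal_mul (by positivity), ← mul_assoc,
      inv_mul_cancel₀ hpos.ne', one_mul]
  · simp only [dotProduct, Matrix.mulVec, Pi.sub_apply]
    fun_prop

/-- The moment generating function of a linear form in a Gaussian vector. -/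
theorem lintegral_exp_linear (μ v : ι → ℝ) {φ : ℝ} (hφ : 0 < φ) :
    ∫⁻ y, ENNReal.ofReal (Real.exp (v ⬝ᵥ (y - μ)))
        ∂(Measure.pi fun i => gaussianReal (μ i) φ.toNNReal) =
      ENNReal.ofReal (Real.exp (φ * (v ⬝ᵥ v) / 2)) := by
  have hpos : 0 < √(2 * Real.pi * φ) ^ Fintype.card ι := by positivity
  rw [lintegral_pi_gaussianReal μ hφ]
  · have : ∀ x : ι → ℝ, ENNReal.ofReal (Real.exp (-(x ⬝ᵥ x) / (2 * φ))) *
        ENNReal.ofReal (Real.exp (v ⬝ᵥ (x + μ - μ))) =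
        ENNReal.ofReal (Real.exp (-((x - φ • v) ⬝ᵥ (x - φ • v)) / (2 * φ))) *
          ENNReal.ofReal (Real.exp (φ * (v ⬝ᵥ v) / 2)) := by
      intro x
      rw [← ENNReal.ofReal_mul (by positivity), ← ENNReal.ofReal_mul (by positivity),
        ← Real.exp_add, ← Real.exp_add, add_sub_cancel_right]
      congr 2
      simp only [sub_dotProduct, dotProduct_sub, smul_dotProduct, dotProduct_smul, smul_eq_mul,
        dotProduct_comm x v]
      field_simp
      ring
    simp only [this]
    rw [lintegral_mul_const, lintegral_sub_right_eq_self
      (fun x : ι → ℝ => ENNReal.ofReal (Real.exp (-(x ⬝ᵥ x) / (2 * φ)))),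
      lintegral_exp_neg_dotProduct hφ, ← mul_assoc, ← ENNReal.ofReal_mul (by positivity),
      inv_mul_cancel₀ hpos.ne', ENNReal.ofReal_one, one_mul]
    simp only [dotProduct, Pi.sub_apply]
    fun_prop
  · simp only [dotProduct, Pi.sub_apply]
    fun_prop

end Gaussian

/-! ### Integrating out the coefficients -/

section Ridge

variable {ι κ : Type} [Fintype ι] [Fintype κ] [DecidableEq κ]

/-- The penalized residual sum of squares, proportional to minus the logarithm of the joint density
of data and coefficients. -/
def penalizedRss (X : Matrix ι κ ℝ) (V : Matrix κ κ ℝ) (τ : ℝ) (y : ι → ℝ) (θ : κ → ℝ) : ℝ :=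
  (y - X *ᵥ θ) ⬝ᵥ (y - X *ᵥ θ) + τ⁻¹ * (θ ⬝ᵥ (V⁻¹ *ᵥ θ))

/-- The precision matrix of the coefficients given the data, up to the factor `φ⁻¹`. -/
def ridgeMatrix (X : Matrix ι κ ℝ) (V : Matrix κ κ ℝ) (τ : ℝ) : Matrix κ κ ℝ :=
  Xᵀ * X + τ⁻¹ • V⁻¹

/-- The minimizer of `penalizedRss`. -/
def ridgeEstimator (X : Matrix ι κ ℝ) (V : Matrix κ κ ℝ) (τ : ℝ) (y : ι → ℝ) : κ → ℝ :=
  (ridgeMatrix X V τ)⁻¹ *ᵥ (Xᵀ *ᵥ y)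

/-- The minimum of `penalizedRss`. -/
def ridgeRss (X : Matrix ι κ ℝ) (V : Matrix κ κ ℝ) (τ : ℝ) (y : ι → ℝ) : ℝ :=
  penalizedRss X V τ y (ridgeEstimator X V τ y)

theorem posDef_ridgeMatrix (X : Matrix ι κ ℝ) {V : Matrix κ κ ℝ} (hV : V.PosDef) {τ : ℝ}
    (hτ : 0 < τ) : (ridgeMatrix X V τ).PosDef := by
  have := Matrix.posSemidef_conjTranspose_mul_self X
  rw [Matrix.conjTranspose_eq_transpose_of_trivial] at this
  exact Matrix.PosDef.posSemidef_add this (hV.inv.smul (inv_pos.2 hτ))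

/-- Completing the square: the normal equations `hnormal` cancel the cross term. -/
theorem penalizedRss_eq (X : Matrix ι κ ℝ) {V : Matrix κ κ ℝ} (hV : V.PosDef) {τ : ℝ}
    (hτ : 0 < τ) (y : ι → ℝ) (θ : κ → ℝ) :
    penalizedRss X V τ y θ =
      (θ - ridgeEstimator X V τ y) ⬝ᵥ (ridgeMatrix X V τ *ᵥ (θ - ridgeEstimator X V τ y)) +
        ridgeRss X V τ y := by
  have hA := posDef_ridgeMatrix X hV hτ
  set e := ridgeEstimator X V τ y with he
  have hnormal : ridgeMatrix X V τ *ᵥ e = Xᵀ *ᵥ y := by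
    rw [he, ridgeEstimator, Matrix.mulVec_mulVec,
      Matrix.mul_nonsing_inv _ ((Matrix.isUnit_iff_isUnit_det _).1 hA.isUnit), Matrix.one_mulVec]
  obtain ⟨h, rfl⟩ : ∃ h, θ = e + h := ⟨θ - e, by simp⟩
  have hsymm : ∀ u w : κ → ℝ, u ⬝ᵥ (V⁻¹ *ᵥ w) = w ⬝ᵥ (V⁻¹ *ᵥ u) := by
    intro u w
    have : V⁻¹ᵀ = V⁻¹ := by
      rw [← Matrix.conjTranspose_eq_transpose_of_trivial]; exact hV.inv.isHermitian
    rw [Matrix.dotProduct_mulVec, ← Matrix.mulVec_transpose, this, dotProduct_comm]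
  have hX : ∀ (u : κ → ℝ) (w : ι → ℝ), (X *ᵥ u) ⬝ᵥ w = u ⬝ᵥ (Xᵀ *ᵥ w) := by
    intro u w
    rw [Matrix.dotProduct_mulVec, Matrix.vecMul_transpose]
  have h1 : h ⬝ᵥ (Xᵀ *ᵥ y) = h ⬝ᵥ (Xᵀ *ᵥ (X *ᵥ e)) + τ⁻¹ * (h ⬝ᵥ (V⁻¹ *ᵥ e)) := by
    rw [← hnormal, ridgeMatrix, Matrix.add_mulVec, Matrix.smul_mulVec, dotProduct_add,
      dotProduct_smul, Matrix.mulVec_mulVec, smul_eq_mul]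
  rw [add_sub_cancel_left, ridgeRss, ← he]
  simp only [penalizedRss, ridgeMatrix, Matrix.mulVec_add, Matrix.add_mulVec, Matrix.smul_mulVec,
    dotProduct_add, add_dotProduct, dotProduct_sub, sub_dotProduct, dotProduct_smul, smul_eq_mul,
    ← Matrix.mulVec_mulVec]
  rw [hsymm e h]
  have h2 := hX h y
  have h3 := hX h (X *ᵥ e)
  have h4 := hX h (X *ᵥ h)
  rw [dotProduct_comm y (X *ᵥ h), dotProduct_comm (X *ᵥ e) (X *ᵥ h)]
  linarith

/-- Since τV(X'X + τ⁻¹V⁻¹) = 1 + τVX'X, the normalizing constants of prior and conditional posterior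
combine into a determinant that depends only on the eigenvalues of VX'X. -/
theorem det_ridgeMatrix (X : Matrix ι κ ℝ) {V : Matrix κ κ ℝ} (hV : V.PosDef) {τ : ℝ}
    (hτ : 0 < τ) :
    τ ^ Fintype.card κ * V.det * (ridgeMatrix X V τ).det =
      (1 + τ • (V * (Xᵀ * X))).det := by
  rw [← Matrix.det_smul, ← Matrix.det_mul, ridgeMatrix, Matrix.mul_add, Matrix.smul_mul,
    Matrix.smul_mul, Matrix.mul_smul,
    Matrix.mul_nonsing_inv _ ((Matrix.isUnit_iff_isUnit_det _).1 hV.isUnit), smul_smul,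
    mul_inv_cancel₀ hτ.ne', one_smul, add_comm]

theorem sqrt_pow_eq (x : ℝ) (hx : 0 ≤ x) (k : ℕ) : √(x ^ k) = √x ^ k := by
  rw [Real.sqrt_eq_iff_mul_self_eq (by positivity) (by positivity), ← mul_pow,
    Real.mul_self_sqrt hx]

theorem normalPdf_smul {V : Matrix κ κ ℝ} (hV : V.PosDef) {c : ℝ} (hc : 0 < c) (μ x : κ → ℝ) :
    normalPdf μ (c • V) x = (√(2 * Real.pi * c) ^ Fintype.card κ * √V.det)⁻¹ *
      Real.exp (-((x - μ) ⬝ᵥ (V⁻¹ *ᵥ (x - μ))) / (2 * c)) := by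
  have hinv : (c • V)⁻¹ = c⁻¹ • V⁻¹ :=
    Matrix.inv_smul' (A := V) (Units.mk0 c hc.ne') ((Matrix.isUnit_iff_isUnit_det _).1 hV.isUnit)
  rw [normalPdf, hinv, Matrix.det_smul, ← mul_assoc, ← mul_pow, Real.sqrt_mul (by positivity),
    Matrix.smul_mulVec, dotProduct_smul, smul_eq_mul, sqrt_pow_eq _ (by positivity)]
  congr 2
  field_simp

theorem lintegral_normalPdf_mul_normalPdf [DecidableEq ι] (X : Matrix ι κ ℝ) {V : Matrix κ κ ℝ}
    (hV : V.PosDef) {τ : ℝ} (hτ : 0 < τ) {φ : ℝ} (hφ : 0 < φ) (y : ι → ℝ) {c : ℝ} (hc : 0 ≤ c) :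
    ∫⁻ θ : κ → ℝ, ENNReal.ofReal (normalPdf (X *ᵥ θ) (φ • (1 : Matrix ι ι ℝ)) y *
        normalPdf 0 ((τ * φ) • V) θ * c) =
      ENNReal.ofReal (c * (√(2 * Real.pi * φ) ^ Fintype.card ι)⁻¹ *
        (√(1 + τ • (V * (Xᵀ * X))).det)⁻¹ * Real.exp (-ridgeRss X V τ y / (2 * φ))) := by
  set k := c * (√(2 * Real.pi * φ) ^ Fintype.card ι)⁻¹ *
    (√(2 * Real.pi * (τ * φ)) ^ Fintype.card κ * √V.det)⁻¹ *
      Real.exp (-ridgeRss X V τ y / (2 * φ)) with hk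
  have hk0 : 0 ≤ k := by positivity
  have key : ∀ θ : κ → ℝ, ENNReal.ofReal (normalPdf (X *ᵥ θ) (φ • (1 : Matrix ι ι ℝ)) y *
        normalPdf 0 ((τ * φ) • V) θ * c) = ENNReal.ofReal k *
      ENNReal.ofReal (Real.exp (-((θ - ridgeEstimator X V τ y) ⬝ᵥ
        (ridgeMatrix X V τ *ᵥ (θ - ridgeEstimator X V τ y))) / (2 * φ))) := by
    intro θ
    rw [normalPdf_smul Matrix.PosDef.one hφ, normalPdf_smul hV (by positivity),
      ← ENNReal.ofReal_mul hk0]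
    congr 1
    have h := penalizedRss_eq X hV hτ y θ
    have e : Real.exp (-((y - X *ᵥ θ) ⬝ᵥ ((1 : Matrix ι ι ℝ)⁻¹ *ᵥ (y - X *ᵥ θ))) / (2 * φ)) *
        Real.exp (-((θ - 0) ⬝ᵥ (V⁻¹ *ᵥ (θ - 0))) / (2 * (τ * φ))) =
        Real.exp (-ridgeRss X V τ y / (2 * φ)) *
        Real.exp (-((θ - ridgeEstimator X V τ y) ⬝ᵥ
        (ridgeMatrix X V τ *ᵥ (θ - ridgeEstimator X V τ y))) / (2 * φ)) := by
      rw [← Real.exp_add, ← Real.exp_add, inv_one, Matrix.one_mulVec, sub_zero]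
      congr 1
      rw [penalizedRss] at h
      rw [eq_sub_of_add_eq h.symm]
      field_simp
      ring
    rw [hk, Matrix.det_one, Real.sqrt_one, mul_one]
    linear_combination c * (√(2 * Real.pi * φ) ^ Fintype.card ι)⁻¹ *
      (√(2 * Real.pi * (τ * φ)) ^ Fintype.card κ * √V.det)⁻¹ * e
  simp only [key]
  have hA := posDef_ridgeMatrix X hV hτ
  rw [lintegral_const_mul, lintegral_sub_right_eq_self
      (fun θ : κ → ℝ => ENNReal.ofReal (Real.exp (-(θ ⬝ᵥ (ridgeMatrix X V τ *ᵥ θ)) / (2 * φ)))),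
      lintegral_exp_neg_posDef hA hφ, ← ENNReal.ofReal_mul hk0]
  · congr 1
    have h1 := hA.det_pos
    have h2 := hV.det_pos
    rw [← det_ridgeMatrix X hV hτ, Real.sqrt_mul (by positivity) (ridgeMatrix X V τ).det,
      Real.sqrt_mul (by positivity) V.det, sqrt_pow_eq _ hτ.le, hk,
      show 2 * Real.pi * (τ * φ) = 2 * Real.pi * φ * τ by ring,
      Real.sqrt_mul (by positivity) τ, mul_pow]
    have := Real.pi_pos
    field_simp
  · simp only [dotProduct, Matrix.mulVec, Pi.sub_apply]
    fun_prop

end Ridge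

/-! ### Integrating out the variance -/

section InverseGamma

/-- The integral of the unnormalized inverse gamma density. -/
def invGammaIntegral (N s : ℝ) : ℝ≥0∞ :=
  ∫⁻ x in Ioi (0 : ℝ), ENNReal.ofReal (x ^ (-(N / 2 + 1)) * Real.exp (-s / (2 * x)))

/-- The scaling x ↦ sx extracts the power of s. The remaining integral is the same for all models
and cancels in the posterior, so only its being neither 0 nor ∞ matters. -/
theorem invGammaIntegral_eq (N : ℝ) {s : ℝ} (hs : 0 < s) :
    invGammaIntegral N s = ENNReal.ofReal (s ^ (-(N / 2))) * invGammaIntegral N 1 := by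
  have himg : (fun x : ℝ => s * x) '' Ioi 0 = Ioi 0 := by
    rw [image_mul_left_Ioi hs, mul_zero]
  rw [invGammaIntegral, ← himg, lintegral_image_eq_lintegral_abs_deriv_mul measurableSet_Ioi
    (f' := fun _ => s) (fun x _ => by simpa using ((hasDerivAt_id x).const_mul s).hasDerivWithinAt)
    (fun x _ y _ h => mul_left_cancel₀ hs.ne' h), invGammaIntegral, ← lintegral_const_mul]
  · refine setLIntegral_congr_fun measurableSet_Ioi fun x hx => ?_
    have hx : 0 < x := hx
    rw [← ENNReal.ofReal_mul (abs_nonneg _), ← ENNReal.ofReal_mul (by positivity), abs_of_pos hs,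
      Real.mul_rpow hs.le hx.le, show -(N / 2) = 1 + -(N / 2 + 1) by ring, Real.rpow_add hs,
      Real.rpow_one]
    congr 1
    rw [show -s / (2 * (s * x)) = -1 / (2 * x) by field_simp]
    ring
  · fun_prop

theorem invGammaIntegral_ne_zero (N s : ℝ) : invGammaIntegral N s ≠ 0 := by
  rw [invGammaIntegral, ← pos_iff_ne_zero, setLIntegral_pos_iff (by fun_prop)]
  refine lt_of_lt_of_le (b := volume (Ioi (0 : ℝ))) (by simp) (measure_mono fun x hx => ⟨?_, hx⟩)
  have hx : 0 < x := hx
  simp only [Function.mem_support, ne_eq, ENNReal.ofReal_eq_zero, not_le]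
  positivity

theorem invGammaIntegral_one_ne_top {N : ℝ} (hN : 0 < N) : invGammaIntegral N 1 ≠ ⊤ := by
  have h1 : IntegrableOn (fun x : ℝ => x ^ (N / 2 - 1) * Real.exp (-(1 / 2) * x)) (Ioi 0) := by
    have := integrableOn_rpow_mul_exp_neg_mul_rpow (p := 1) (s := N / 2 - 1) (b := 1 / 2)
      (by linarith) (by norm_num) (by norm_num)
    simpa using this
  -- The substitution x ↦ 1/x turns the gamma integral into the inverse gamma integral.
  rw [← integrableOn_Ioi_comp_rpow_iff _ (p := -1) (by norm_num)] at h1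
  have h2 : IntegrableOn (fun x : ℝ => x ^ (-(N / 2 + 1)) * Real.exp (-1 / (2 * x))) (Ioi 0) := by
    refine h1.congr_fun (fun x hx => ?_) measurableSet_Ioi
    have hx : 0 < x := hx
    simp only [smul_eq_mul]
    rw [← Real.rpow_mul hx.le, ← mul_assoc, abs_neg, abs_one, one_mul, ← Real.rpow_add hx,
      Real.rpow_neg_one]
    congr 2
    · ring
    · field_simp
  exact (Integrable.lintegral_lt_top h2).ne

end InverseGamma

/-! ### Projections and residual sums of squares -/

section Hat

variable {ι κ : Type} [Fintype ι] [Fintype κ] [DecidableEq κ]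

/-- The orthogonal projection onto the column space of `X`. -/
def hat (X : Matrix ι κ ℝ) : Matrix ι ι ℝ := X * (Xᵀ * X)⁻¹ * Xᵀ

theorem hat_transpose (X : Matrix ι κ ℝ) : (hat X)ᵀ = hat X := by
  simp [hat, Matrix.transpose_mul, Matrix.transpose_nonsing_inv, Matrix.mul_assoc]

theorem hat_mul_self {X : Matrix ι κ ℝ} (hX : IsUnit (Xᵀ * X).det) : hat X * X = X := by
  rw [hat, Matrix.mul_assoc, Matrix.mul_assoc, Matrix.nonsing_inv_mul _ hX, Matrix.mul_one]

theorem hat_idem {X : Matrix ι κ ℝ} (hX : IsUnit (Xᵀ * X).det) : hat X * hat X = hat X := by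
  nth_rw 2 [hat]
  rw [← Matrix.mul_assoc, ← Matrix.mul_assoc, hat_mul_self hX, hat]

theorem dotProduct_projection {P : Matrix ι ι ℝ} (hT : Pᵀ = P) (hI : P * P = P) (u v : ι → ℝ) :
    u ⬝ᵥ (P *ᵥ v) = (P *ᵥ u) ⬝ᵥ (P *ᵥ v) := by
  nth_rw 1 [← hI]
  rw [← Matrix.mulVec_mulVec, Matrix.dotProduct_mulVec, ← Matrix.mulVec_transpose, hT]

theorem dotProduct_self_nonneg_real (u : ι → ℝ) : 0 ≤ u ⬝ᵥ u :=
  Finset.sum_nonneg fun _ _ => mul_self_nonneg _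

theorem ridgeRss_le_penalizedRss (X : Matrix ι κ ℝ) {V : Matrix κ κ ℝ}
    (hV : V.PosDef) {τ : ℝ} (hτ : 0 < τ) (y : ι → ℝ) (θ : κ → ℝ) :
    ridgeRss X V τ y ≤ penalizedRss X V τ y θ := by
  rw [penalizedRss_eq X hV hτ]
  have := (posDef_ridgeMatrix X hV hτ).posSemidef.dotProduct_mulVec_nonneg
    (θ - ridgeEstimator X V τ y)
  simp only [star_trivial] at this
  linarith

theorem projection_nonneg {P : Matrix ι ι ℝ} (hT : Pᵀ = P) (hI : P * P = P) (u : ι → ℝ) :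
    0 ≤ u ⬝ᵥ (P *ᵥ u) := by
  rw [dotProduct_projection hT hI]
  exact dotProduct_self_nonneg_real _

theorem projection_add_le {P : Matrix ι ι ℝ} (hT : Pᵀ = P) (hI : P * P = P) (u v : ι → ℝ) :
    (u + v) ⬝ᵥ (P *ᵥ (u + v)) ≤ 2 * (u ⬝ᵥ (P *ᵥ u)) + 2 * (v ⬝ᵥ (P *ᵥ v)) := by
  have h := projection_nonneg hT hI (u - v)
  simp only [Matrix.mulVec_add, Matrix.mulVec_sub, dotProduct_add, add_dotProduct, dotProduct_sub,
    sub_dotProduct] at h ⊢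
  linarith

variable [DecidableEq ι]

/-- The residual sum of squares. -/
def rss (X : Matrix ι κ ℝ) (y : ι → ℝ) : ℝ := y ⬝ᵥ ((1 - hat X) *ᵥ y)

theorem one_sub_projection {P : Matrix ι ι ℝ} (hT : Pᵀ = P) (hI : P * P = P) :
    (1 - P)ᵀ = 1 - P ∧ (1 - P) * (1 - P) = 1 - P := by
  constructor
  · simp [hT]
  · rw [Matrix.sub_mul, Matrix.mul_sub, Matrix.mul_sub, hI]
    simp

theorem projection_le {P : Matrix ι ι ℝ} (hT : Pᵀ = P) (hI : P * P = P) (u : ι → ℝ) :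
    u ⬝ᵥ (P *ᵥ u) ≤ u ⬝ᵥ u := by
  have h := projection_nonneg (one_sub_projection hT hI).1 (one_sub_projection hT hI).2 u
  rw [Matrix.sub_mulVec, Matrix.one_mulVec, dotProduct_sub] at h
  linarith

theorem rss_nonneg {X : Matrix ι κ ℝ} (hX : IsUnit (Xᵀ * X).det) (y : ι → ℝ) : 0 ≤ rss X y :=
  have h := one_sub_projection (hat_transpose X) (hat_idem hX)
  projection_nonneg h.1 h.2 y

theorem rss_sub_mulVec {X : Matrix ι κ ℝ} (hX : IsUnit (Xᵀ * X).det) (y : ι → ℝ) (θ : κ → ℝ) :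
    rss X (y - X *ᵥ θ) = rss X y := by
  have h := one_sub_projection (hat_transpose X) (hat_idem hX)
  have h0 : (1 - hat X) *ᵥ (X *ᵥ θ) = 0 := by
    rw [Matrix.mulVec_mulVec, Matrix.sub_mul, hat_mul_self hX, Matrix.one_mul, sub_self,
      Matrix.zero_mulVec]
  rw [rss, rss, dotProduct_projection h.1 h.2, dotProduct_projection h.1 h.2 y, Matrix.mulVec_sub,
    h0, sub_zero]

theorem rss_le_penalizedRss {X : Matrix ι κ ℝ} (hX : IsUnit (Xᵀ * X).det) {V : Matrix κ κ ℝ}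
    (hV : V.PosDef) {τ : ℝ} (hτ : 0 < τ) (y : ι → ℝ) (θ : κ → ℝ) :
    rss X y ≤ penalizedRss X V τ y θ := by
  have h := one_sub_projection (hat_transpose X) (hat_idem hX)
  have h1 := projection_le h.1 h.2 (y - X *ᵥ θ)
  have h2 : 0 ≤ θ ⬝ᵥ (V⁻¹ *ᵥ θ) := by simpa using hV.inv.posSemidef.dotProduct_mulVec_nonneg θ
  rw [← rss_sub_mulVec hX y θ]
  exact h1.trans (le_add_of_nonneg_right (by positivity))

theorem rss_le_ridgeRss {X : Matrix ι κ ℝ} (hX : IsUnit (Xᵀ * X).det) {V : Matrix κ κ ℝ}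
    (hV : V.PosDef) {τ : ℝ} (hτ : 0 < τ) (y : ι → ℝ) : rss X y ≤ ridgeRss X V τ y :=
  rss_le_penalizedRss hX hV hτ _ _

/-- Shrinkage increases the residual sum of squares by at most the squared length of the projection
of the data, divided by the smallest eigenvalue of `τ V X' X`. -/
theorem ridgeRss_le {X : Matrix ι κ ℝ} (hX : IsUnit (Xᵀ * X).det) {V : Matrix κ κ ℝ}
    (hV : V.PosDef) {τ : ℝ} (hτ : 0 < τ) {ρ : ℝ} (hρ : 0 < ρ)
    (h : ∀ θ : κ → ℝ, ρ * (θ ⬝ᵥ (V⁻¹ *ᵥ θ)) ≤ θ ⬝ᵥ ((Xᵀ * X) *ᵥ θ)) (y : ι → ℝ) :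
    ridgeRss X V τ y ≤ rss X y + (y ⬝ᵥ (hat X *ᵥ y)) / (τ * ρ) := by
  -- The least squares estimator is a competitor in the ridge minimization: its residual is exactly
  -- `rss`, and `h` bounds its penalty by the length of the fitted vector.
  have h1 := ridgeRss_le_penalizedRss X hV hτ y ((Xᵀ * X)⁻¹ *ᵥ (Xᵀ *ᵥ y))
  have h2 := h ((Xᵀ * X)⁻¹ *ᵥ (Xᵀ *ᵥ y))
  set θ := (Xᵀ * X)⁻¹ *ᵥ (Xᵀ *ᵥ y) with hθ
  have h3 : X *ᵥ θ = hat X *ᵥ y := by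
    rw [hθ, Matrix.mulVec_mulVec, Matrix.mulVec_mulVec, hat]
  have h4 : θ ⬝ᵥ ((Xᵀ * X) *ᵥ θ) = y ⬝ᵥ (hat X *ᵥ y) := by
    rw [dotProduct_projection (hat_transpose X) (hat_idem hX), ← h3, ← Matrix.mulVec_mulVec,
      Matrix.dotProduct_mulVec, Matrix.vecMul_transpose]
  have h5 : (y - X *ᵥ θ) ⬝ᵥ (y - X *ᵥ θ) = rss X y := by
    have h := one_sub_projection (hat_transpose X) (hat_idem hX)
    rw [rss, dotProduct_projection h.1 h.2, Matrix.sub_mulVec, Matrix.one_mulVec, h3]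
  rw [penalizedRss, h5] at h1
  rw [h4] at h2
  refine h1.trans (add_le_add_right ?_ _)
  rw [inv_mul_eq_div, div_le_div_iff₀ hτ (by positivity)]
  calc θ ⬝ᵥ (V⁻¹ *ᵥ θ) * (τ * ρ) = τ * (ρ * (θ ⬝ᵥ (V⁻¹ *ᵥ θ))) := by ring
    _ ≤ τ * (y ⬝ᵥ (hat X *ᵥ y)) := by gcongr
    _ = _ := by ring

theorem ridgeRss_of_isEmpty [IsEmpty κ] (X : Matrix ι κ ℝ) (V : Matrix κ κ ℝ) (τ : ℝ) (y : ι → ℝ) :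
    ridgeRss X V τ y = rss X y := by
  simp [ridgeRss, penalizedRss, rss, hat, dotProduct, Matrix.mulVec, Matrix.mul_apply,
    Matrix.sub_apply, Matrix.one_apply]

/-- Sylvester's identity det(1 + AB) = det(1 + BA) moves the determinant to the column index, where
the Gram matrix cancels. -/
theorem det_one_add_smul_hat {X : Matrix ι κ ℝ} (hX : IsUnit (Xᵀ * X).det) (c : ℝ) :
    (1 + c • hat X).det = (1 + c) ^ Fintype.card κ := by
  have : c • hat X = X * (c • ((Xᵀ * X)⁻¹ * Xᵀ)) := by
    rw [hat, Matrix.mul_smul, Matrix.mul_assoc]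
  rw [this, Matrix.det_one_add_mul_comm, Matrix.smul_mul, Matrix.mul_assoc,
    Matrix.nonsing_inv_mul _ hX]
  have : (1 : Matrix κ κ ℝ) + c • 1 = (1 + c) • 1 := by rw [add_smul, one_smul]
  rw [this, Matrix.det_smul, Matrix.det_one, mul_one]

end Hat

/-! ### Spectrum of a product of two positive definite matrices -/

section Eigenvalues

variable {κ : Type} [Fintype κ] [DecidableEq κ]

theorem le_quadratic_of_eigenvalues {M : Matrix κ κ ℝ} (hM : M.IsHermitian) {ρ : ℝ}
    (hρ : ∀ x ∈ M.charpoly.roots, ρ ≤ x) (x : κ → ℝ) : ρ * (x ⬝ᵥ x) ≤ x ⬝ᵥ (M *ᵥ x) := by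
  have h : (M - ρ • (1 : Matrix κ κ ℝ)).PosSemidef := by
    rw [Matrix.posSemidef_iff_isHermitian_and_spectrum_nonneg]
    have h1 : (ρ • (1 : Matrix κ κ ℝ)) = algebraMap ℝ _ ρ := (Algebra.algebraMap_eq_smul_one ρ).symm
    refine ⟨hM.sub (by rw [Matrix.IsHermitian]; simp), ?_⟩
    rw [h1, ← spectrum.sub_singleton_eq]
    rintro _ ⟨z, hz, w, rfl, rfl⟩
    rw [Matrix.mem_spectrum_iff_isRoot_charpoly] at hz
    have := hρ z ((Polynomial.mem_roots (Matrix.charpoly_monic M).ne_zero).2 hz)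
    simpa using this
  have := h.dotProduct_mulVec_nonneg x
  simp only [star_trivial, Matrix.sub_mulVec, Matrix.smul_mulVec, Matrix.one_mulVec, dotProduct_sub,
    dotProduct_smul, smul_eq_mul] at this
  linarith

theorem det_one_add_smul_eq_prod {M : Matrix κ κ ℝ} (hM : M.IsHermitian) (τ : ℝ) :
    (1 + τ • M).det = (M.charpoly.roots.map fun x => τ * x + 1).prod := by
  rcases eq_or_ne τ 0 with rfl | hτ
  · simp
  -- The determinant is read off from the characteristic polynomial at -1/τ, which is why τ = 0 is
  -- treated apart.
  have h1 : 1 + τ • M = (-τ) • (Matrix.scalar κ (-τ⁻¹) - M) := by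
    rw [smul_sub, Matrix.scalar_apply, ← Matrix.smul_one_eq_diagonal, smul_smul, neg_mul_neg,
      mul_inv_cancel₀ hτ, one_smul, neg_smul, sub_neg_eq_add]
  rw [h1, Matrix.det_smul, ← Matrix.eval_charpoly, hM.roots_charpoly_eq_eigenvalues, hM.charpoly_eq,
    Polynomial.eval_prod, ← Finset.card_univ, ← Finset.prod_const, ← Finset.prod_mul_distrib,
    Multiset.map_map]
  refine Finset.prod_congr rfl fun i _ => ?_
  simp only [Polynomial.eval_sub, Polynomial.eval_X, Polynomial.eval_C, Function.comp_apply]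
  field_simp
  simp

variable {V G : Matrix κ κ ℝ}

/-- The product of two positive definite matrices is similar to a positive definite one. -/
theorem exists_posDef_of_mul (hV : V.PosDef) (hG : G.PosDef) :
    ∃ B : Matrix κ κ ℝ, B.det ≠ 0 ∧ V = Bᵀ * B ∧ (B * G * Bᵀ).PosDef ∧
      (V * G).charpoly = (B * G * Bᵀ).charpoly := by
  obtain ⟨B, hB, rfl⟩ := exists_isUnit_transpose_mul_self hV
  refine ⟨B, hB, rfl, ?_, ?_⟩
  · have := hG.mul_mul_conjTranspose_same (B := B)
      (Matrix.vecMul_injective_iff_isUnit.2 ((Matrix.isUnit_iff_isUnit_det _).2 hB.isUnit))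
    rwa [Matrix.conjTranspose_eq_transpose_of_trivial] at this
  · rw [Matrix.mul_assoc, Matrix.charpoly_mul_comm]

theorem posDef_mul_roots_pos (hV : V.PosDef) (hG : G.PosDef) :
    ∀ x ∈ (V * G).charpoly.roots, 0 < x := by
  obtain ⟨B, hB, -, hM, hc⟩ := exists_posDef_of_mul hV hG
  rw [hc, hM.isHermitian.roots_charpoly_eq_eigenvalues]
  intro x hx
  obtain ⟨i, -, rfl⟩ := Multiset.mem_map.1 hx
  exact hM.eigenvalues_pos i

theorem posDef_mul_card_roots (hV : V.PosDef) (hG : G.PosDef) :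
    (V * G).charpoly.roots.card = Fintype.card κ := by
  obtain ⟨B, hB, -, hM, hc⟩ := exists_posDef_of_mul hV hG
  rw [hc, hM.isHermitian.roots_charpoly_eq_eigenvalues]
  simp

theorem posDef_mul_det (hV : V.PosDef) (hG : G.PosDef) (τ : ℝ) :
    (1 + τ • (V * G)).det = ((V * G).charpoly.roots.map fun x => τ * x + 1).prod := by
  obtain ⟨B, hB, hVB, hM, hc⟩ := exists_posDef_of_mul hV hG
  rw [hc, ← det_one_add_smul_eq_prod hM.isHermitian, hVB, ← Matrix.mul_smul,
    Matrix.mul_assoc, Matrix.det_one_add_mul_comm, Matrix.mul_smul, Matrix.smul_mul]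

/-- In the coordinates θ = Bᵀx, with V = BᵀB, the penalty form becomes x'x and the form of G becomes
that of the symmetric matrix BGBᵀ, which has the eigenvalues of VG. -/
theorem posDef_mul_quadratic (hV : V.PosDef) (hG : G.PosDef) {ρ : ℝ}
    (hρ : ∀ x ∈ (V * G).charpoly.roots, ρ ≤ x) (θ : κ → ℝ) :
    ρ * (θ ⬝ᵥ (V⁻¹ *ᵥ θ)) ≤ θ ⬝ᵥ (G *ᵥ θ) := by
  obtain ⟨B, hB, hVB, hM, hc⟩ := exists_posDef_of_mul hV hG
  rw [hc] at hρ
  have hBT : IsUnit Bᵀ.det := by rw [Matrix.det_transpose]; exact hB.isUnit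
  obtain ⟨x, rfl⟩ : ∃ x, θ = Bᵀ *ᵥ x :=
    ⟨Bᵀ⁻¹ *ᵥ θ, by rw [Matrix.mulVec_mulVec, Matrix.mul_nonsing_inv _ hBT, Matrix.one_mulVec]⟩
  have h := le_quadratic_of_eigenvalues hM.isHermitian hρ x
  have e1 : (Bᵀ *ᵥ x) ⬝ᵥ (G *ᵥ (Bᵀ *ᵥ x)) = x ⬝ᵥ ((B * G * Bᵀ) *ᵥ x) := by
    rw [Matrix.mulVec_transpose B x, ← Matrix.dotProduct_mulVec, ← Matrix.mulVec_transpose,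
      Matrix.mulVec_mulVec, Matrix.mulVec_mulVec, Matrix.mul_assoc]
  have e2 : (Bᵀ *ᵥ x) ⬝ᵥ (V⁻¹ *ᵥ (Bᵀ *ᵥ x)) = x ⬝ᵥ x := by
    rw [hVB, Matrix.mul_inv_rev, Matrix.mulVec_mulVec, Matrix.mul_assoc,
      Matrix.nonsing_inv_mul _ hBT, Matrix.mul_one, Matrix.mulVec_transpose B x,
      ← Matrix.dotProduct_mulVec, Matrix.mulVec_mulVec, Matrix.mul_nonsing_inv _ hB.isUnit,
      Matrix.one_mulVec]
  rw [e1, e2]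
  exact h

end Eigenvalues

/-! ### Closed form of the evidence and bounds by posterior odds -/

namespace Problem

variable {n : ℕ} (D : Problem n)

theorem isUnit_det_gram {k : Finset (Fin D.p)} (hk : k.card ≤ D.pbar) :
    IsUnit ((cols D.X k)ᵀ * cols D.X k).det := D.gram_isUnit k hk

theorem posDef_gram {k : Finset (Fin D.p)} (hk : k.card ≤ D.pbar) : (gram D.X k).PosDef := by
  have h := Matrix.posSemidef_conjTranspose_mul_self (cols D.X k)
  rw [Matrix.conjTranspose_eq_transpose_of_trivial] at h
  exact h.posDef_iff_isUnit.2 ((Matrix.isUnit_iff_isUnit_det _).2 (D.isUnit_det_gram hk))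

theorem rho_pos {k : Finset (Fin D.p)} (hk : k.card ≤ D.pbar) : ∀ x ∈ D.rho k, 0 < x :=
  posDef_mul_roots_pos (D.V_posDef k hk) (D.posDef_gram hk)

theorem rhoProd_pos {k : Finset (Fin D.p)} (hk : k.card ≤ D.pbar) : 0 < D.rhoProd k := by
  refine Multiset.prod_pos fun z hz => ?_
  obtain ⟨x, hx, rfl⟩ := Multiset.mem_map.1 hz
  have := D.rho_pos hk x hx
  have := D.tau_pos
  positivity

theorem rhoProd_eq {k : Finset (Fin D.p)} (hk : k.card ≤ D.pbar) :
    D.rhoProd k = √(1 + D.tau • (D.V k * gram D.X k)).det := by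
  rw [posDef_mul_det (D.V_posDef k hk) (D.posDef_gram hk), Real.sqrt_eq_rpow, rhoProd,
    Real.multiset_prod_map_rpow]
  · rfl
  · intro x hx
    have := D.rho_pos hk x hx
    have := D.tau_pos
    positivity

/-- The sum of squares whose power is the integrated likelihood. -/
def fit (k : Finset (Fin D.p)) (y : Fin n → ℝ) : ℝ := ridgeRss (cols D.X k) (D.V k) D.tau y

theorem rss_le_fit {k : Finset (Fin D.p)} (hk : k.card ≤ D.pbar) (y : Fin n → ℝ) :
    rss (cols D.X k) y ≤ D.fit k y :=
  rss_le_ridgeRss (D.isUnit_det_gram hk) (D.V_posDef k hk) D.tau_pos y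

theorem fit_nonneg {k : Finset (Fin D.p)} (hk : k.card ≤ D.pbar) (y : Fin n → ℝ) :
    0 ≤ D.fit k y :=
  (rss_nonneg (D.isUnit_det_gram hk) y).trans (D.rss_le_fit hk y)

/-- The constant depends neither on the model nor on the data, so it cancels in every posterior
probability. -/
theorem exists_evidence_eq {a l : ℝ} (ha : 0 < a) (hl : 0 < l) :
    ∃ C : ℝ≥0∞, C ≠ 0 ∧ C ≠ ⊤ ∧ ∀ k : Finset (Fin D.p), k.card ≤ D.pbar → ∀ y,
      D.evidence a l k y =
        C * ENNReal.ofReal ((D.rhoProd k)⁻¹ * (l + D.fit k y) ^ (-(((n : ℝ) + a) / 2))) := by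
  set c := (l / 2) ^ (a / 2) / Real.Gamma (a / 2) * (√(2 * Real.pi) ^ n)⁻¹ with hc
  have hc0 : 0 < c := by
    have := Real.Gamma_pos_of_pos (half_pos ha)
    positivity
  refine ⟨ENNReal.ofReal c * invGammaIntegral (n + a) 1,
    mul_ne_zero (by rwa [Ne, ENNReal.ofReal_eq_zero, not_le]) (invGammaIntegral_ne_zero _ _),
    ENNReal.mul_ne_top ENNReal.ofReal_ne_top (invGammaIntegral_one_ne_top (by positivity)), ?_⟩
  intro k hk y
  have hr := D.rhoProd_pos hk
  have key : D.evidence a l k y = ENNReal.ofReal (c * (D.rhoProd k)⁻¹) *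
      invGammaIntegral (n + a) (l + D.fit k y) := by
    rw [evidence, invGammaIntegral, ← lintegral_const_mul]
    · refine setLIntegral_congr_fun measurableSet_Ioi fun φ hφ => ?_
      have hφ : 0 < φ := hφ
      have h0 : 0 ≤ invGammaPdf (a / 2) (l / 2) φ := by
        have := Real.Gamma_pos_of_pos (half_pos ha)
        rw [invGammaPdf]
        positivity
      have h1 : √φ ^ n = φ ^ ((n : ℝ) / 2) := by
        rw [Real.sqrt_eq_rpow, ← Real.rpow_mul_natCast hφ.le]
        congr 1
        ring
      have h2 : φ ^ (-(((n : ℝ) + a) / 2 + 1)) = φ ^ (-(a / 2 + 1)) * (φ ^ ((n : ℝ) / 2))⁻¹ := by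
        rw [← Real.rpow_neg hφ.le, ← Real.rpow_add hφ]
        congr 1
        ring
      have h3 : Real.exp (-(l + D.fit k y) / (2 * φ)) =
          Real.exp (-(l / 2) / φ) * Real.exp (-D.fit k y / (2 * φ)) := by
        rw [← Real.exp_add]
        congr 1
        field_simp
        ring
      have h := lintegral_normalPdf_mul_normalPdf (cols D.X k) (D.V_posDef k hk) D.tau_pos hφ y h0
      refine h.trans ?_
      rw [← ENNReal.ofReal_mul (by positivity), h2, h3, D.rhoProd_eq hk, hc, invGammaPdf, ← h1,
        Fintype.card_fin, Real.sqrt_mul (by positivity) φ, mul_pow, mul_inv]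
      congr 1
      change _ * (√(1 + D.tau • (D.V k * gram D.X k)).det)⁻¹ * Real.exp (-D.fit k y / (2 * φ)) = _
      ring
    · fun_prop
  rw [key, invGammaIntegral_eq _ (add_pos_of_pos_of_nonneg hl (D.fit_nonneg hk y)),
    ENNReal.ofReal_mul hc0.le, ENNReal.ofReal_mul (inv_nonneg.2 hr.le)]
  clear_value c
  ring

theorem posterior_nonneg (a l : ℝ) (m : Finset (Fin D.p)) (y : Fin n → ℝ) :
    0 ≤ D.posterior a l m y := ENNReal.toReal_nonneg

theorem posterior_le_one (a l : ℝ) {m : Finset (Fin D.p)} (hm : m.card ≤ D.pbar)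
    (y : Fin n → ℝ) : D.posterior a l m y ≤ 1 := by
  refine ENNReal.toReal_le_of_le_ofReal zero_le_one ?_
  rw [ENNReal.ofReal_one]
  refine ENNReal.div_le_of_le_mul ?_
  rw [one_mul]
  exact Finset.single_le_sum (f := fun k : Finset (Fin D.p) =>
    D.evidence a l k y * ENNReal.ofReal (D.prior k.card)) (fun _ _ => zero_le)
    (Finset.mem_filter.2 ⟨Finset.mem_univ m, hm⟩)

/-- The posterior probability of a model is at most its posterior odds against the true model. -/
theorem posterior_le_odds {a l : ℝ} (ha : 0 < a) (hl : 0 < l) {m : Finset (Fin D.p)}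
    (hm : m.card ≤ D.pbar) (y : Fin n → ℝ) :
    D.posterior a l m y ≤ D.odds m * (D.rhoProd D.t / D.rhoProd m) *
      ((l + D.fit D.t y) / (l + D.fit m y)) ^ (((n : ℝ) + a) / 2) := by
  obtain ⟨C, hC0, hC, h⟩ := D.exists_evidence_eq ha hl
  have hpm := D.prior_pos m hm
  have hpt := D.prior_pos D.t D.t_card
  have hrm := D.rhoProd_pos hm
  have hrt := D.rhoProd_pos D.t_card
  have hsm := add_pos_of_pos_of_nonneg hl (D.fit_nonneg hm y)
  have hst := add_pos_of_pos_of_nonneg hl (D.fit_nonneg D.t_card y)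
  have ho : 0 ≤ D.odds m := (div_pos hpm hpt).le
  refine ENNReal.toReal_le_of_le_ofReal (by positivity) ?_
  have hle := Finset.single_le_sum (f := fun k : Finset (Fin D.p) =>
    D.evidence a l k y * ENNReal.ofReal (D.prior k.card)) (fun _ _ => zero_le)
    (Finset.mem_filter.2 ⟨Finset.mem_univ D.t, D.t_card⟩ :
      D.t ∈ Finset.univ.filter fun k : Finset (Fin D.p) => k.card ≤ D.pbar)
  refine (ENNReal.div_le_div_left hle _).trans ?_
  rw [h m hm, h D.t D.t_card, mul_assoc, mul_assoc, ENNReal.mul_div_mul_left _ _ hC0 hC,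
    ← ENNReal.ofReal_mul (by positivity), ← ENNReal.ofReal_mul (by positivity),
    ← ENNReal.ofReal_div_of_pos (by positivity)]
  refine ENNReal.ofReal_le_ofReal (le_of_eq ?_)
  rw [Real.div_rpow hst.le hsm.le, Real.rpow_neg hst.le, Real.rpow_neg hsm.le, odds]
  have := Real.rpow_pos_of_pos hst (((n : ℝ) + a) / 2)
  have := Real.rpow_pos_of_pos hsm (((n : ℝ) + a) / 2)
  field_simp

theorem rhoMin_le : ∀ x ∈ D.rho D.t, D.rhoMin ≤ x := fun _ hx =>
  csInf_le ⟨0, fun z hz => (D.rho_pos D.t_card z hz).le⟩ hx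

theorem rhoMin_pos (ht : D.t.Nonempty) : 0 < D.rhoMin := by
  have hne : {x | x ∈ D.rho D.t}.Nonempty := by
    have h : 0 < (D.rho D.t).card := by
      rw [rho, posDef_mul_card_roots (D.V_posDef D.t D.t_card) (D.posDef_gram D.t_card)]
      simpa using ht
    obtain ⟨x, hx⟩ := Multiset.card_pos_iff_exists_mem.1 h
    exact ⟨x, hx⟩
  have hfin : {x | x ∈ D.rho D.t}.Finite := by
    have := (D.rho D.t).toFinset.finite_toSet
    simp
  exact D.rho_pos D.t_card _ (hne.csInf_mem hfin)

/-- A bound on the increase of the residual sum of squares of the true model by shrinkage. -/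
def shrinkage (y : Fin n → ℝ) : ℝ :=
  if D.t = ∅ then 0 else (y ⬝ᵥ (hat (cols D.X D.t) *ᵥ y)) / (D.tau * D.rhoMin)

theorem fit_le (y : Fin n → ℝ) :
    D.fit D.t y ≤ rss (cols D.X D.t) y + D.shrinkage y := by
  rw [shrinkage, fit]
  split_ifs with ht
  · have : IsEmpty D.t := by rw [ht]; infer_instance
    rw [ridgeRss_of_isEmpty, add_zero]
  · exact ridgeRss_le (D.isUnit_det_gram D.t_card) (D.V_posDef _ D.t_card) D.tau_pos
      (D.rhoMin_pos (Finset.nonempty_iff_ne_empty.2 ht))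
      (posDef_mul_quadratic (D.V_posDef _ D.t_card) (D.posDef_gram D.t_card) D.rhoMin_le) y

theorem odds_pos {m : Finset (Fin D.p)} (hm : m.card ≤ D.pbar) : 0 < D.odds m :=
  div_pos (D.prior_pos m hm) (D.prior_pos D.t D.t_card)

/-- Replaces the ridge sums of squares by ordinary ones, whose Gaussian law is explicit; the price
is the single error term `shrinkage` in the numerator. -/
theorem posterior_le {a l : ℝ} (ha : 0 < a) (hl : 0 < l) {m : Finset (Fin D.p)}
    (hm : m.card ≤ D.pbar) (y : Fin n → ℝ) :
    D.posterior a l m y ≤ D.odds m * (D.rhoProd D.t / D.rhoProd m) *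
      ((l + rss (cols D.X D.t) y + D.shrinkage y) / (l + rss (cols D.X m) y)) ^
        (((n : ℝ) + a) / 2) := by
  have h1 := D.fit_nonneg D.t_card y
  have h2 := D.fit_le y
  have h3 := D.rss_le_fit hm y
  have h4 := rss_nonneg (D.isUnit_det_gram hm) y
  have h5 := D.odds_pos hm
  have h6 := D.rhoProd_pos hm
  have h7 := D.rhoProd_pos D.t_card
  refine (D.posterior_le_odds ha hl hm y).trans ?_
  gcongr ?_ * ?_ ^ _
  · exact div_nonneg (by linarith) (by linarith)
  · exact div_le_div₀ (by linarith) (by linarith) (by linarith) (by linarith)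

end Problem

/-! ### Gaussian vectors and nested column spaces -/

section NestedProjections

variable {ι κ κ' : Type} [Fintype ι] [Fintype κ] [DecidableEq κ] [Fintype κ'] [DecidableEq κ']
  {X : Matrix ι κ ℝ} {Y : Matrix ι κ' ℝ}

theorem hat_mul_hat (hYX : hat Y * X = X) : hat Y * hat X = hat X := by
  nth_rw 2 [hat]
  rw [← Matrix.mul_assoc, ← Matrix.mul_assoc, hYX, hat]

theorem hat_mul_hat' (hYX : hat Y * X = X) : hat X * hat Y = hat X := by
  have := congrArg Matrix.transpose (hat_mul_hat hYX)
  rwa [Matrix.transpose_mul, hat_transpose, hat_transpose] at this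

/-- For nested column spaces the difference of the two projections is itself an orthogonal
projection. -/
theorem hat_sub_hat_nonneg (hX : IsUnit (Xᵀ * X).det) (hY : IsUnit (Yᵀ * Y).det)
    (hYX : hat Y * X = X) (x : ι → ℝ) : 0 ≤ x ⬝ᵥ ((hat Y - hat X) *ᵥ x) := by
  refine projection_nonneg ?_ ?_ x
  · rw [Matrix.transpose_sub, hat_transpose, hat_transpose]
  · rw [Matrix.sub_mul, Matrix.mul_sub, Matrix.mul_sub, hat_idem hX, hat_idem hY, hat_mul_hat hYX,
      hat_mul_hat' hYX, sub_self, sub_zero]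

variable [DecidableEq ι]

/-- The quadratic form with coefficients `b₀`, `b₁`, `b₂` on the column space of `X`, its complement
in the column space of `Y`, and the complement of the latter. -/
def nestedForm (X : Matrix ι κ ℝ) (Y : Matrix ι κ' ℝ) (b₀ b₁ b₂ : ℝ) : Matrix ι ι ℝ :=
  b₀ • hat X + b₁ • (hat Y - hat X) + b₂ • (1 - hat Y)

theorem one_sub_nestedForm (X : Matrix ι κ ℝ) (Y : Matrix ι κ' ℝ) (b₀ b₁ b₂ : ℝ) :
    1 - nestedForm X Y b₀ b₁ b₂ = nestedForm X Y (1 - b₀) (1 - b₁) (1 - b₂) := by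
  simp only [nestedForm]
  module

theorem nestedForm_mulVec (X : Matrix ι κ ℝ) (Y : Matrix ι κ' ℝ) (b₀ b₁ b₂ : ℝ) (x : ι → ℝ) :
    x ⬝ᵥ (nestedForm X Y b₀ b₁ b₂ *ᵥ x) = b₀ * (x ⬝ᵥ (hat X *ᵥ x)) +
      b₁ * (x ⬝ᵥ ((hat Y - hat X) *ᵥ x)) + b₂ * rss Y x := by
  simp only [nestedForm, Matrix.add_mulVec, Matrix.smul_mulVec, dotProduct_add, dotProduct_smul,
    smul_eq_mul, rss]

theorem posDef_nestedForm (hX : IsUnit (Xᵀ * X).det) (hY : IsUnit (Yᵀ * Y).det)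
    (hYX : hat Y * X = X) {b₀ b₁ b₂ : ℝ} (h₀ : 0 < b₀) (h₁ : 0 < b₁) (h₂ : 0 < b₂) :
    (nestedForm X Y b₀ b₁ b₂).PosDef := by
  refine Matrix.PosDef.of_dotProduct_mulVec_pos ?_ fun x hx => ?_
  · rw [Matrix.IsHermitian, Matrix.conjTranspose_eq_transpose_of_trivial, nestedForm]
    simp only [Matrix.transpose_add, Matrix.transpose_smul, Matrix.transpose_sub, hat_transpose,
      Matrix.transpose_one]
  · rw [star_trivial, nestedForm_mulVec]
    have q₀ := projection_nonneg (hat_transpose X) (hat_idem hX) x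
    have q₁ := hat_sub_hat_nonneg hX hY hYX x
    have q₂ := rss_nonneg hY x
    have hsum : x ⬝ᵥ x = x ⬝ᵥ (hat X *ᵥ x) + x ⬝ᵥ ((hat Y - hat X) *ᵥ x) + rss Y x := by
      rw [rss, Matrix.sub_mulVec, Matrix.sub_mulVec, Matrix.one_mulVec, dotProduct_sub,
        dotProduct_sub]
      ring
    have hpos : 0 < x ⬝ᵥ x := by
      have := Matrix.dotProduct_star_self_pos_iff.2 hx
      rwa [star_trivial] at this
    set c := min b₀ (min b₁ b₂)
    have hc : 0 < c := lt_min h₀ (lt_min h₁ h₂)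
    have c₀ : c ≤ b₀ := min_le_left _ _
    have c₁ : c ≤ b₁ := (min_le_right _ _).trans (min_le_left _ _)
    have c₂ : c ≤ b₂ := (min_le_right _ _).trans (min_le_right _ _)
    calc 0 < c * (x ⬝ᵥ x) := mul_pos hc hpos
      _ = c * (x ⬝ᵥ (hat X *ᵥ x)) + c * (x ⬝ᵥ ((hat Y - hat X) *ᵥ x)) + c * rss Y x := by
        rw [hsum]; ring
      _ ≤ _ := by gcongr

/-- The determinant of a combination of the projections onto two nested column spaces. -/
theorem det_nestedForm (hX : IsUnit (Xᵀ * X).det) (hY : IsUnit (Yᵀ * Y).det)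
    (hYX : hat Y * X = X) {b₀ b₁ b₂ : ℝ} (h₁ : b₁ ≠ 0) (h₂ : b₂ ≠ 0) :
    (nestedForm X Y b₀ b₁ b₂).det = (b₀ / b₁) ^ Fintype.card κ * (b₁ / b₂) ^ Fintype.card κ' *
      b₂ ^ Fintype.card ι := by
  -- Because hat X * hat Y = hat X, the form factors into two perturbations of the identity by one
  -- projection each, whose determinants are known.
  have h : nestedForm X Y b₀ b₁ b₂ =
      (1 + (b₀ / b₁ - 1) • hat X) * (b₂ • (1 + (b₁ / b₂ - 1) • hat Y)) := by
    simp only [Matrix.mul_smul, Matrix.add_mul, Matrix.one_mul, Matrix.mul_add, Matrix.mul_one,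
      Matrix.smul_mul, hat_mul_hat' hYX, smul_add, smul_smul, nestedForm]
    match_scalars <;> field_simp <;> ring
  rw [h, Matrix.det_mul, Matrix.det_smul, det_one_add_smul_hat hX, det_one_add_smul_hat hY,
    add_sub_cancel, add_sub_cancel]
  ring

/-- The joint moment generating function of the squared lengths of the components of a Gaussian
vector in nested column spaces. -/
theorem lintegral_exp_nestedForm (hX : IsUnit (Xᵀ * X).det) (hY : IsUnit (Yᵀ * Y).det)
    (hYX : hat Y * X = X) {b₀ b₁ b₂ : ℝ} (h₀ : b₀ < 1) (h₁ : b₁ < 1) (h₂ : b₂ < 1) (μ : ι → ℝ)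
    {φ : ℝ} (hφ : 0 < φ) :
    ∫⁻ y, ENNReal.ofReal (Real.exp (((y - μ) ⬝ᵥ (nestedForm X Y b₀ b₁ b₂ *ᵥ (y - μ))) / (2 * φ)))
        ∂(Measure.pi fun i => gaussianReal (μ i) φ.toNNReal) =
      ENNReal.ofReal (√(((1 - b₀) / (1 - b₁)) ^ Fintype.card κ *
        ((1 - b₁) / (1 - b₂)) ^ Fintype.card κ' * (1 - b₂) ^ Fintype.card ι))⁻¹ := by
  rw [lintegral_exp_quadratic μ hφ, one_sub_nestedForm,
    det_nestedForm hX hY hYX (sub_pos.2 h₁).ne' (sub_pos.2 h₂).ne']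
  rw [one_sub_nestedForm]
  exact posDef_nestedForm hX hY hYX (sub_pos.2 h₀) (sub_pos.2 h₁) (sub_pos.2 h₂)

/-- The moment generating function of the squared length of a projection of a Gaussian vector. -/
theorem lintegral_exp_hat (hX : IsUnit (Xᵀ * X).det) {b : ℝ} (hb : b < 1) (μ : ι → ℝ)
    {φ : ℝ} (hφ : 0 < φ) :
    ∫⁻ y, ENNReal.ofReal (Real.exp (b * ((y - μ) ⬝ᵥ (hat X *ᵥ (y - μ))) / (2 * φ)))
        ∂(Measure.pi fun i => gaussianReal (μ i) φ.toNNReal) =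
      ENNReal.ofReal (√((1 - b) ^ Fintype.card κ))⁻¹ := by
  have h := lintegral_exp_nestedForm hX hX (hat_mul_self hX) hb hb zero_lt_one μ hφ
  have hb' : 1 - b ≠ 0 := (sub_pos.2 hb).ne'
  simp only [nestedForm_mulVec, sub_self, Matrix.zero_mulVec, dotProduct_zero, mul_zero, add_zero,
    zero_mul, div_self hb', one_pow, one_mul, sub_zero, div_one, mul_one] at h
  exact h

/-- The moment generating function of the residual sum of squares of Gaussian noise. -/
theorem lintegral_exp_rss (hX : IsUnit (Xᵀ * X).det) {b : ℝ} (hb : b < 1) (μ : ι → ℝ)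
    {φ : ℝ} (hφ : 0 < φ) :
    ∫⁻ y, ENNReal.ofReal (Real.exp (b * rss X (y - μ) / (2 * φ)))
        ∂(Measure.pi fun i => gaussianReal (μ i) φ.toNNReal) =
      ENNReal.ofReal (√((1 - b)⁻¹ ^ Fintype.card κ * (1 - b) ^ Fintype.card ι))⁻¹ := by
  have h := lintegral_exp_nestedForm hX hX (hat_mul_self hX) zero_lt_one zero_lt_one hb μ hφ
  simp only [nestedForm_mulVec, sub_self, Matrix.zero_mulVec, dotProduct_zero, mul_zero, add_zero,
    zero_mul, zero_add, sub_zero, div_one, one_pow, one_mul, one_div] at h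
  exact h

theorem lintegral_exp_normSq {b : ℝ} (hb : b < 1) (μ : ι → ℝ) {φ : ℝ} (hφ : 0 < φ) :
    ∫⁻ y, ENNReal.ofReal (Real.exp (b * ((y - μ) ⬝ᵥ (y - μ)) / (2 * φ)))
        ∂(Measure.pi fun i => gaussianReal (μ i) φ.toNNReal) =
      ENNReal.ofReal (√((1 - b) ^ Fintype.card ι))⁻¹ := by
  have e : (1 : Matrix ι ι ℝ) - b • 1 = (1 - b) • 1 := by rw [sub_smul, one_smul]
  have h := lintegral_exp_quadratic μ hφ (M := b • (1 : Matrix ι ι ℝ))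
    (by rw [e]; exact Matrix.PosDef.one.smul (sub_pos.2 hb))
  rw [e, Matrix.det_smul, Matrix.det_one, mul_one] at h
  simpa only [Matrix.smul_mulVec, Matrix.one_mulVec, dotProduct_smul, smul_eq_mul] using h

end NestedProjections

/-! ### Exponential envelopes for a power of 1 + u/x -/

section Envelope

/-- Slopes of exponential envelopes of the left branch of `ν / 2 * (u - 1 - log u)`. -/
theorem exists_envelope_slope {ν : ℝ} (hν : 0 < ν) {j : ℝ} (hj : 0 ≤ j) :
    ∃ b : ℝ, 0 ≤ b ∧ ∀ u ∈ Ioo (0 : ℝ) 1, j ≤ ν / 2 * (u - 1 - Real.log u) →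
      Real.exp j ≤ (1 + b) ^ (ν / 2) * Real.exp (-(b * (ν * u) / 2)) := by
  set h : ℝ → ℝ := fun u => u - 1 - Real.log u with hh
  set c := 2 * j / ν with hc
  have hc0 : 0 ≤ c := by positivity
  have hle : Real.exp (-(c + 1)) ≤ 1 := Real.exp_le_one_iff.2 (by linarith)
  have hcont : ContinuousOn h (Icc (Real.exp (-(c + 1))) 1) := by
    refine (continuousOn_id.sub continuousOn_const).sub (Real.continuousOn_log.mono fun x hx => ?_)
    exact ((Real.exp_pos _).trans_le hx.1).ne'
  -- v is the point of the left branch at level j. With 1 + b = 1/v, the optimal Chernoff slope at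
  -- v, the right-hand side equals exp j at u = v; it decreases in u, so it dominates exp j for all
  -- u ≤ v.
  obtain ⟨v, hv, hvc⟩ : c ∈ h '' Icc (Real.exp (-(c + 1))) 1 := by
    refine intermediate_value_Icc' hle hcont ⟨?_, ?_⟩
    · simpa [hh] using hc0
    · have := Real.exp_pos (-(c + 1))
      simp only [hh, Real.log_exp]
      linarith
  have hv0 : 0 < v := (Real.exp_pos _).trans_le hv.1
  refine ⟨v⁻¹ - 1, sub_nonneg.2 ((one_le_inv₀ hv0).2 hv.2), fun u hu hju => ?_⟩
  have hcu : c ≤ h u := by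
    rw [hc, div_le_iff₀ hν]
    simp only [hh]
    linarith
  have huv : u ≤ v := by
    by_contra! hlt
    have h1 := Real.log_lt_sub_one_of_pos (div_pos hv0 hu.1) (div_lt_one hu.1 |>.2 hlt).ne
    rw [Real.log_div hv0.ne' hu.1.ne'] at h1
    have h2 : v / u - 1 ≤ v - u := by
      rw [div_sub_one hu.1.ne', div_le_iff₀ hu.1]
      nlinarith [hu.2]
    rw [← hvc] at hcu
    simp only [hh] at hcu
    linarith
  have hj' : j = ν / 2 * (v - 1 - Real.log v) := by
    have : v - 1 - Real.log v = 2 * j / ν := hvc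
    rw [this]
    field_simp
  rw [add_sub_cancel, Real.rpow_def_of_pos (inv_pos.2 hv0), ← Real.exp_add, Real.log_inv,
    Real.exp_le_exp]
  have h3 : (v⁻¹ - 1) * u ≤ 1 - v := by
    calc (v⁻¹ - 1) * u ≤ (v⁻¹ - 1) * v := by
          gcongr
          exact sub_nonneg.2 ((one_le_inv₀ hv0).2 hv.2)
      _ = 1 - v := by field_simp
  rw [hj']
  nlinarith

/-- Split log(1 + u/x) as log((x+u)/ν) - log(x/ν) and linearize only the first logarithm at 1. The
second gives the convex rate function of the lower chi-square tail. -/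
theorem one_add_div_rpow_le {ν : ℝ} (hν : 0 < ν) {u x : ℝ} (hx : 0 < x) (hu : 0 ≤ u) :
    (1 + u / x) ^ (ν / 2) ≤
      Real.exp (ν / 2 * (x / ν - 1 - Real.log (x / ν)) + u / 2) := by
  have h0 : 0 < 1 + u / x := by positivity
  rw [Real.rpow_def_of_pos h0, Real.exp_le_exp]
  have h1 := Real.log_le_sub_one_of_pos (x := (x + u) / ν) (by positivity)
  have h2 : 1 + u / x = (x + u) / ν / (x / ν) := by field_simp
  rw [h2, Real.log_div (by positivity) (by positivity)]
  have h3 : u / 2 = ν / 2 * (u / ν) := by field_simp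
  rw [h3, ← mul_add, mul_comm]
  refine mul_le_mul_of_nonneg_left ?_ (by positivity)
  rw [add_div] at h1 ⊢
  linarith

/-- A power of `1 + u / x` is dominated by a sum of exponentials that are linear in `u` and `x`. -/
theorem exists_envelope {ν : ℝ} (hν : 0 < ν) {s : ℝ} (hs : s ∈ Ioo (0 : ℝ) 1) :
    ∃ b : ℕ → ℝ, (∀ j, 0 ≤ b j) ∧ ∀ u x : ℝ, 0 ≤ u → 0 < x → ∃ j : ℕ,
      (1 + u / x) ^ (s * ν / 2) ≤ Real.exp (s * (j + 1) - j) *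
        ((1 + b j) ^ (ν / 2) * Real.exp (-(b j * x / 2)) * Real.exp (s * u / 2)) := by
  choose b hb0 hb using fun j : ℕ => exists_envelope_slope hν (Nat.cast_nonneg (α := ℝ) j)
  -- Slope 0 at j = 0 lets this term serve also for x ≥ ν, outside the left branch.
  refine ⟨fun j => if j = 0 then 0 else b j, fun j => ?_, fun u x hu hx => ?_⟩
  · dsimp only
    split_ifs
    · exact le_rfl
    · exact hb0 j
  have hpow : (1 + u / x) ^ (s * ν / 2) = ((1 + u / x) ^ (ν / 2)) ^ s := by
    rw [← Real.rpow_mul (by positivity)]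
    congr 1
    ring
  have hs0 := hs.1
  rcases le_or_gt ν x with hνx | hxν
  · refine ⟨0, ?_⟩
    simp only [if_true, Nat.cast_zero, add_zero, Real.one_rpow, zero_mul, zero_div, neg_zero,
      Real.exp_zero, one_mul, mul_one, zero_add, sub_zero]
    have h1 : (1 + u / x) ^ (s * ν / 2) ≤ Real.exp (u / x) ^ (s * ν / 2) := by
      gcongr
      rw [add_comm]
      exact Real.add_one_le_exp _
    refine h1.trans ?_
    rw [← Real.exp_mul, ← Real.exp_add, Real.exp_le_exp]
    have h2 : u / x * (s * ν / 2) = s * u / 2 * (ν / x) := by ring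
    have h3 : ν / x ≤ 1 := (div_le_one hx).2 hνx
    have h4 : 0 ≤ s * u / 2 := by positivity
    nlinarith
  · set w := ν / 2 * (x / ν - 1 - Real.log (x / ν)) with hw
    have hxν0 : 0 < x / ν := by positivity
    have hw0 : 0 ≤ w := by
      have := Real.log_le_sub_one_of_pos hxν0
      exact mul_nonneg (by positivity) (by linarith)
    -- Slicing by the integer part j of the rate w: exp(sw) ≤ exp(s(j+1) - j) exp(j), and exp(j) is
    -- dominated by the Chernoff function of level j. The weights are summable because s < 1.
    refine ⟨⌊w⌋₊, ?_⟩
    have h1 : Real.exp (⌊w⌋₊ : ℝ) ≤ (1 + (if ⌊w⌋₊ = 0 then 0 else b ⌊w⌋₊)) ^ (ν / 2) *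
        Real.exp (-((if ⌊w⌋₊ = 0 then 0 else b ⌊w⌋₊) * x / 2)) := by
      split_ifs with h0
      · simp [h0]
      · have := hb ⌊w⌋₊ (x / ν) ⟨hxν0, (div_lt_one hν).2 hxν⟩ (Nat.floor_le hw0)
        rwa [mul_div_cancel₀ _ hν.ne'] at this
    have h2 : (1 + u / x) ^ (s * ν / 2) ≤ Real.exp (s * (⌊w⌋₊ + 1) + s * u / 2) := by
      rw [hpow]
      calc ((1 + u / x) ^ (ν / 2)) ^ s ≤ Real.exp (w + u / 2) ^ s := by
            gcongr
            exact one_add_div_rpow_le hν hx hu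
        _ = Real.exp (s * (w + u / 2)) := by rw [← Real.exp_mul, mul_comm]
        _ ≤ _ := by
          rw [Real.exp_le_exp]
          have := (Nat.lt_floor_add_one w).le
          nlinarith
    calc _ ≤ _ := h2
      _ = Real.exp (s * (⌊w⌋₊ + 1) - ⌊w⌋₊) * (Real.exp ⌊w⌋₊ * Real.exp (s * u / 2)) := by
        rw [← Real.exp_add, ← Real.exp_add]
        congr 1
        ring
      _ ≤ _ := by gcongr

end Envelope

/-! ### Spurious models at fixed sample size -/

theorem rss_sub_of_hat_mulVec {ι κ : Type} [Fintype ι] [DecidableEq ι] [Fintype κ] [DecidableEq κ]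
    {X : Matrix ι κ ℝ} (hX : IsUnit (Xᵀ * X).det) {μ : ι → ℝ} (h : hat X *ᵥ μ = μ) (y : ι → ℝ) :
    rss X (y - μ) = rss X y := by
  rw [← h, hat, Matrix.mul_assoc, ← Matrix.mulVec_mulVec, rss_sub_mulVec hX]

theorem hat_cols_mul_cols {n p : ℕ} {X : Matrix (Fin n) (Fin p) ℝ} {k k' : Finset (Fin p)}
    (h : k ⊆ k') (hX : IsUnit (gram X k').det) : hat (cols X k') * cols X k = cols X k := by
  ext i j
  exact congrFun (congrFun (hat_mul_self (X := cols X k') hX) i) ⟨j, h j.2⟩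

theorem measurable_exp_quadratic {n : ℕ} (M : Matrix (Fin n) (Fin n) ℝ)
    (μ : Fin n → ℝ) (b c : ℝ) :
    Measurable fun y : Fin n → ℝ =>
      ENNReal.ofReal (Real.exp (b * ((y - μ) ⬝ᵥ (M *ᵥ (y - μ))) / c)) := by
  simp only [dotProduct, Matrix.mulVec, Pi.sub_apply]
  fun_prop

/-- The normalizing constant of the envelope of the posterior odds against a spurious model. -/
def envelopeConst (s : ℝ) : ℝ := Real.exp s * (1 - Real.exp (-(1 - s)))⁻¹

theorem envelopeConst_nonneg {s : ℝ} (hs : s < 1) : 0 ≤ envelopeConst s := by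
  have : Real.exp (-(1 - s)) ≤ 1 := Real.exp_le_one_iff.2 (by linarith)
  exact mul_nonneg (Real.exp_pos _).le (inv_nonneg.2 (by linarith))

theorem tsum_envelope {s : ℝ} (hs : s < 1) :
    ∑' j : ℕ, ENNReal.ofReal (Real.exp (s * (j + 1) - j)) = ENNReal.ofReal (envelopeConst s) := by
  have h1 : Real.exp (-(1 - s)) < 1 := by rw [Real.exp_lt_one_iff]; linarith
  have h2 : ∀ j : ℕ, Real.exp (s * (j + 1) - j) = Real.exp s * Real.exp (-(1 - s)) ^ j := by
    intro j
    rw [← Real.exp_nat_mul, ← Real.exp_add]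
    congr 1
    ring
  simp only [h2]
  rw [← ENNReal.ofReal_tsum_of_nonneg (fun j => by positivity)
    ((summable_geometric_of_lt_one (Real.exp_pos _).le h1).mul_left _), tsum_mul_left,
    tsum_geometric_of_lt_one (Real.exp_pos _).le h1, envelopeConst]

/-- As p ≤ 1, p ≤ p^s, so the exponent may be lowered below the degrees of freedom. Since R + U >
eNφ, the shrinkage error W is a relative perturbation of order 1/N, whose power stays below a
constant. -/
theorem le_of_le_odds {a l φ e s ν s' N p x₀ R U W : ℝ} (ha : 0 < a) (hl : 0 < l)
    (he : 0 < e) (hN : 1 ≤ N) (hs : s ∈ Ioo (0 : ℝ) 1) (hss : s * (N + a) ≤ s' * ν)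
    (hp0 : 0 ≤ p) (hp1 : p ≤ 1) (hx₀ : 0 ≤ x₀) (hR : 0 ≤ R) (hU : 0 ≤ U)
    (hRU : e * N * φ < R + U) (hW : W ≤ 10 * φ) (hfit : 0 ≤ l + (R + U) + W)
    (hp : p ≤ x₀ * ((l + (R + U) + W) / (l + R)) ^ ((N + a) / 2)) :
    p ≤ x₀ ^ s * Real.exp (5 * (1 + a) / e) * (1 + U / (l + R)) ^ (s' * ν / 2) := by
  have hs0 := hs.1
  have hN0 : 0 < N := one_pos.trans_le hN
  have h1 : p ≤ p ^ s := by
    have := Real.rpow_le_rpow_of_exponent_ge' hp0 hp1 hs0.le hs.2.le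
    rwa [Real.rpow_one] at this
  have hratio : (l + (R + U) + W) / (l + R) ≤ (1 + 10 / (e * N)) * (1 + U / (l + R)) := by
    have h2 : (l + (R + U) + W) ≤ (1 + 10 / (e * N)) * (l + R + U) := by
      have h3 : 10 * φ ≤ 10 / (e * N) * (l + R + U) := by
        rw [div_mul_eq_mul_div, le_div_iff₀ (by positivity)]
        linarith
      linarith
    calc _ ≤ (1 + 10 / (e * N)) * (l + R + U) / (l + R) := by gcongr
      _ = _ := by field_simp
  have hratio0 : 0 ≤ (l + (R + U) + W) / (l + R) := div_nonneg hfit (by positivity)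
  have hone : 1 ≤ 1 + U / (l + R) := le_add_of_nonneg_right (by positivity)
  have hexp : (1 + 10 / (e * N)) ^ (s * (N + a) / 2) ≤ Real.exp (5 * (1 + a) / e) := by
    calc (1 + 10 / (e * N)) ^ (s * (N + a) / 2) ≤
          Real.exp (10 / (e * N)) ^ (s * (N + a) / 2) := by
            gcongr
            rw [add_comm]
            exact Real.add_one_le_exp _
      _ ≤ _ := by
        rw [← Real.exp_mul, Real.exp_le_exp, div_mul_eq_mul_div,
          div_le_div_iff₀ (by positivity) he]
        have h2 : s * (N + a) ≤ 1 * (N + a) := by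
          gcongr
          exact hs.2.le
        have h3 : a * 1 ≤ a * N := by gcongr
        have h4 : s * (N + a) ≤ (1 + a) * N := by linarith
        have := mul_le_mul_of_nonneg_right h4 he.le
        linarith
  calc p ≤ p ^ s := h1
    _ ≤ (x₀ * ((1 + 10 / (e * N)) * (1 + U / (l + R))) ^ ((N + a) / 2)) ^ s := by
      refine Real.rpow_le_rpow hp0 (hp.trans ?_) hs0.le
      gcongr
    _ = x₀ ^ s * ((1 + 10 / (e * N)) ^ (s * (N + a) / 2) *
        (1 + U / (l + R)) ^ (s * (N + a) / 2)) := by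
      rw [Real.mul_rpow hx₀ (by positivity), ← Real.rpow_mul (by positivity),
        Real.mul_rpow (by positivity) (by positivity), mul_comm _ s, mul_div_assoc]
    _ ≤ x₀ ^ s * (Real.exp (5 * (1 + a) / e) * (1 + U / (l + R)) ^ (s' * ν / 2)) := by
      gcongr
    _ = _ := by rw [mul_assoc]

/-- (1+b)^{ν/2} cancels the moment generating function of the residual part exactly, so the bound is
the same for every slope b and the envelope can be summed. -/
theorem lintegral_envelope {ι κ κ' : Type} [Fintype ι] [DecidableEq ι] [Fintype κ]
    [DecidableEq κ] [Fintype κ'] [DecidableEq κ'] {X : Matrix ι κ ℝ} {Y : Matrix ι κ' ℝ}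
    (hX : IsUnit (Xᵀ * X).det) (hY : IsUnit (Yᵀ * Y).det)
    (hYX : hat Y * X = X) {b s : ℝ} (hb : 0 ≤ b) (hs : s < 1) (μ : ι → ℝ) {φ : ℝ} (hφ : 0 < φ)
    {w : ℝ} (hw : 0 ≤ w) :
    ∫⁻ y, ENNReal.ofReal (w * (1 + b) ^ (((Fintype.card ι : ℝ) - Fintype.card κ') / 2)) *
      ENNReal.ofReal (Real.exp
        (1 * ((y - μ) ⬝ᵥ (nestedForm X Y 0 s (-b) *ᵥ (y - μ))) / (2 * φ)))
        ∂(Measure.pi fun i => gaussianReal (μ i) φ.toNNReal) =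
      ENNReal.ofReal w *
        ENNReal.ofReal (√((1 / (1 - s)) ^ Fintype.card κ * (1 - s) ^ Fintype.card κ'))⁻¹ := by
  have hs1 : 0 < 1 - s := sub_pos.2 hs
  rw [lintegral_const_mul]
  · simp only [one_mul]
    rw [lintegral_exp_nestedForm hX hY hYX zero_lt_one hs (by linarith) μ hφ,
      sub_zero, sub_neg_eq_add, ← ENNReal.ofReal_mul (by positivity),
      ← ENNReal.ofReal_mul (by positivity)]
    congr 1
    have hpow : (1 + b) ^ (((Fintype.card ι : ℝ) - Fintype.card κ') / 2) =
        √((1 + b) ^ Fintype.card ι / (1 + b) ^ Fintype.card κ') := by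
      rw [← Real.rpow_natCast, ← Real.rpow_natCast, ← Real.rpow_sub (by positivity),
        Real.sqrt_eq_rpow, ← Real.rpow_mul (by positivity)]
      congr 1
      ring
    have hsplit : (1 / (1 - s)) ^ Fintype.card κ * ((1 - s) / (1 + b)) ^ Fintype.card κ' *
        (1 + b) ^ Fintype.card ι = ((1 / (1 - s)) ^ Fintype.card κ * (1 - s) ^ Fintype.card κ') *
          ((1 + b) ^ Fintype.card ι / (1 + b) ^ Fintype.card κ') := by
      rw [div_pow (1 - s)]
      ring
    rw [hsplit, Real.sqrt_mul (by positivity) ((1 + b) ^ Fintype.card ι / _), hpow, mul_assoc]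
    congr 1
    have : 0 < √((1 + b) ^ Fintype.card ι / (1 + b) ^ Fintype.card κ') := by positivity
    rw [mul_inv, mul_comm (√_)⁻¹, ← mul_assoc, mul_inv_cancel₀ this.ne', one_mul]
  · simp only [dotProduct, Matrix.mulVec, Pi.sub_apply]
    fun_prop

namespace Problem

variable {n : ℕ} (D : Problem n)

theorem hat_mulVec_mean {k : Finset (Fin D.p)} (h : D.t ⊆ k) (hk : k.card ≤ D.pbar) :
    hat (cols D.X k) *ᵥ D.mean = D.mean := by
  rw [mean, Matrix.mulVec_mulVec, hat_cols_mul_cols h (D.gram_isUnit k hk)]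

theorem lam_eq (φ : ℝ) (m : Finset (Fin D.p)) : D.lam φ m = rss (cols D.X m) D.mean / φ := rfl

theorem lam_empty (φ : ℝ) : D.lam φ ∅ = D.mean ⬝ᵥ D.mean / φ := by
  have : hat (cols D.X ∅) = 0 := by
    ext i j
    simp [hat, Matrix.mul_apply]
  rw [lam_eq, rss, this, sub_zero, Matrix.one_mulVec]

theorem lam_nonneg {φ : ℝ} (hφ : 0 < φ) {m : Finset (Fin D.p)} (hm : m.card ≤ D.pbar) :
    0 ≤ D.lam φ m :=
  div_nonneg (rss_nonneg (D.isUnit_det_gram hm) _) hφ.le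

theorem meanPosterior_nonneg (a l φ : ℝ) (m : Finset (Fin D.p)) : 0 ≤ D.meanPosterior a l φ m :=
  integral_nonneg fun y => D.posterior_nonneg a l m y

/-- Passing through the extended norm of the integral makes measurability of the posterior
unnecessary. -/
theorem meanPosterior_le_of_lintegral_le {a l φ : ℝ} {m : Finset (Fin D.p)}
    {F : (Fin n → ℝ) → ℝ≥0∞} (hF : ∀ y, ENNReal.ofReal (D.posterior a l m y) ≤ F y) {B : ℝ}
    (hB : 0 ≤ B) (h : ∫⁻ y, F y ∂(D.truth φ) ≤ ENNReal.ofReal B) :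
    D.meanPosterior a l φ m ≤ B := by
  have h1 := (enorm_integral_le_lintegral_enorm (μ := D.truth φ) (D.posterior a l m)).trans
    ((lintegral_mono fun y => (Real.enorm_of_nonneg (D.posterior_nonneg a l m y)).trans_le
      (hF y)).trans h)
  have h2 := D.meanPosterior_nonneg a l φ m
  rw [meanPosterior] at h2 ⊢
  rw [Real.enorm_of_nonneg h2] at h1
  exact (ENNReal.ofReal_le_ofReal_iff hB).1 h1

/-- An upper bound for the indicator of the event that shrinkage is large. -/
def shrinkageTail (φ : ℝ) (y : Fin n → ℝ) : ℝ≥0∞ :=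
  if D.t = ∅ then 0 else ENNReal.ofReal (Real.exp (-(D.tau * D.rhoMin))) *
    ENNReal.ofReal (Real.exp (1 / 2 *
      ((y - D.mean) ⬝ᵥ (hat (cols D.X D.t) *ᵥ (y - D.mean))) / (2 * φ)))

/-- The expectation of `shrinkageTail`. -/
def shrinkageProb : ℝ :=
  if D.t = ∅ then 0 else
    Real.exp (-(D.tau * D.rhoMin)) * (√((1 - 1 / 2) ^ D.t.card))⁻¹

theorem shrinkageProb_nonneg : 0 ≤ D.shrinkageProb := by
  rw [shrinkageProb]
  split_ifs <;> positivity

theorem lintegral_shrinkageTail {φ : ℝ} (hφ : 0 < φ) :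
    ∫⁻ y, D.shrinkageTail φ y ∂(D.truth φ) = ENNReal.ofReal D.shrinkageProb := by
  unfold shrinkageTail shrinkageProb
  split_ifs
  · simp
  · rw [lintegral_const_mul _ (measurable_exp_quadratic _ _ _ _), truth,
      lintegral_exp_hat (D.isUnit_det_gram D.t_card) (by norm_num) D.mean hφ,
      ENNReal.ofReal_mul (Real.exp_pos _).le, Fintype.card_coe]

/-- Put r = τρ. The squared projection of the data is at most twice that of the mean, itself at most
λ_{t0}φ ≤ rφ, plus twice that of the noise. Exceeding 10rφ thus forces the noise part above 4rφ,
where the exponential majorant is at least 1. -/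
theorem one_le_shrinkageTail {φ : ℝ} (hφ : 0 < φ)
    (hlam : D.t ≠ ∅ → D.lam φ ∅ ≤ D.tau * D.rhoMin) {y : Fin n → ℝ}
    (hy : 10 * φ < D.shrinkage y) : 1 ≤ D.shrinkageTail φ y := by
  unfold shrinkageTail
  unfold shrinkage at hy
  split_ifs at hy ⊢ with ht
  · linarith
  · have hlam := hlam ht
    have hr := mul_pos D.tau_pos (D.rhoMin_pos (Finset.nonempty_iff_ne_empty.2 ht))
    set r := D.tau * D.rhoMin
    rw [lt_div_iff₀ hr] at hy
    rw [D.lam_empty, div_le_iff₀ hφ] at hlam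
    have hT := hat_transpose (cols D.X D.t)
    have hI := hat_idem (D.isUnit_det_gram D.t_card)
    have h1 := projection_add_le hT hI D.mean (y - D.mean)
    rw [add_sub_cancel] at h1
    have h2 := projection_le hT hI D.mean
    rw [← ENNReal.ofReal_mul (Real.exp_pos _).le, ← Real.exp_add, ENNReal.one_le_ofReal,
      Real.one_le_exp_iff, ← sub_eq_neg_add, sub_nonneg, le_div_iff₀ (by positivity)]
    linarith

theorem meanPosterior_spurious_le {a l φ : ℝ} (ha : 0 < a) (hl : 0 < l) (hφ : 0 < φ)
    {m : Finset (Fin D.p)} (hm : D.Spurious m) (hn : 0 < n)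
    (hlam : D.t ≠ ∅ → D.lam φ ∅ ≤ D.tau * D.rhoMin) {e s s' : ℝ} (he : 0 < e)
    (hs : s ∈ Ioo (0 : ℝ) 1) (hs' : s' ∈ Ioo (0 : ℝ) 1) (hcard : m.card < n)
    (hss : s * (n + a) ≤ s' * (n - m.card)) :
    D.meanPosterior a l φ m ≤ D.shrinkageProb +
      Real.exp (n / 2) * (√((1 + e⁻¹)⁻¹ ^ D.t.card * (1 + e⁻¹) ^ n))⁻¹ +
      (D.odds m * (D.rhoProd D.t / D.rhoProd m)) ^ s * Real.exp (5 * (1 + a) / e) *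
        (envelopeConst s' * (√((1 / (1 - s')) ^ D.t.card * (1 - s') ^ m.card))⁻¹) := by
  have hmc := hm.2
  have hUt := D.isUnit_det_gram D.t_card
  have hUm := D.isUnit_det_gram hmc
  have hYX := hat_cols_mul_cols hm.1.subset (D.gram_isUnit m hmc)
  have hs0 := hs.1
  have hs1 : 0 < 1 - s' := sub_pos.2 hs'.2
  have hcard' : (m.card : ℝ) < n := Nat.cast_lt.2 hcard
  have hn' : (1 : ℝ) ≤ n := Nat.one_le_cast.2 hn
  have hodds := D.odds_pos hmc
  have hrm := D.rhoProd_pos hmc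
  have hrt := D.rhoProd_pos D.t_card
  have hB0 : 0 ≤ envelopeConst s' := envelopeConst_nonneg hs'.2
  set ν : ℝ := n - m.card with hν
  have hν0 : 0 < ν := sub_pos.2 hcard'
  obtain ⟨b, hb0, hb⟩ := exists_envelope hν0 hs'
  set x₀ := D.odds m * (D.rhoProd D.t / D.rhoProd m) with hx₀
  have hx₀0 : 0 < x₀ := by positivity
  set c := x₀ ^ s * Real.exp (5 * (1 + a) / e) with hc
  have hc0 : 0 ≤ c := by positivity
  set w := fun j : ℕ => Real.exp (s' * (j + 1) - j) with hw
  set Q := fun j : ℕ => nestedForm (cols D.X D.t) (cols D.X m) 0 s' (-b j) with hQ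
  -- `F₁` is the Chernoff majorant of the event rss_t(ε) ≤ enφ, with slope 1/e; `F₂ j` are the terms
  -- of the envelope without their weights' normalization by c.
  set F₁ := fun y : Fin n → ℝ => ENNReal.ofReal (Real.exp (n / 2)) *
    ENNReal.ofReal (Real.exp (-e⁻¹ * rss (cols D.X D.t) (y - D.mean) / (2 * φ))) with hF₁
  set F₂ := fun (j : ℕ) (y : Fin n → ℝ) => ENNReal.ofReal (w j * (1 + b j) ^ (ν / 2)) *
    ENNReal.ofReal (Real.exp (1 * ((y - D.mean) ⬝ᵥ (Q j *ᵥ (y - D.mean))) / (2 * φ))) with hF₂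
  have hF₂m : ∀ j, Measurable (F₂ j) := fun j => (measurable_exp_quadratic _ _ _ _).const_mul _
  have hF₁m : Measurable F₁ := (measurable_exp_quadratic _ _ _ _).const_mul _
  refine D.meanPosterior_le_of_lintegral_le
    (F := fun y => D.shrinkageTail φ y + F₁ y + ENNReal.ofReal c * ∑' j, F₂ j y) ?_
    (add_nonneg (add_nonneg D.shrinkageProb_nonneg (by positivity)) (by positivity)) ?_
  · intro y
    have hp1 : ENNReal.ofReal (D.posterior a l m y) ≤ 1 := by
      rw [← ENNReal.ofReal_one]
      exact ENNReal.ofReal_le_ofReal (D.posterior_le_one a l hmc y)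
    rcases lt_or_ge (10 * φ) (D.shrinkage y) with hW | hW
    · exact hp1.trans ((D.one_le_shrinkageTail hφ hlam hW).trans
        (le_add_right (le_add_right le_rfl)))
    have hR := rss_sub_of_hat_mulVec hUm (D.hat_mulVec_mean hm.1.subset hmc) y
    have hT := rss_sub_of_hat_mulVec hUt (D.hat_mulVec_mean subset_rfl D.t_card) y
    set ε := y - D.mean with hε
    rcases le_or_gt (rss (cols D.X D.t) ε) (e * n * φ) with hS | hS
    · refine hp1.trans (le_add_right (le_add_left ?_))
      simp only [hF₁]
      rw [← ENNReal.ofReal_mul (Real.exp_pos _).le, ← Real.exp_add, ENNReal.one_le_ofReal,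
        Real.one_le_exp_iff]
      have : e⁻¹ * rss (cols D.X D.t) ε / (2 * φ) ≤ n / 2 := by
        rw [div_le_iff₀ (by positivity), inv_mul_le_iff₀ he]
        linarith
      rw [neg_mul, neg_div]
      linarith
    refine le_add_left ?_
    set U := ε ⬝ᵥ ((hat (cols D.X m) - hat (cols D.X D.t)) *ᵥ ε) with hU
    set R := rss (cols D.X m) ε with hRdef
    have hU0 : 0 ≤ U := hat_sub_hat_nonneg hUt hUm hYX ε
    have hR0 : 0 ≤ R := rss_nonneg hUm ε
    have hTU : rss (cols D.X D.t) ε = R + U := by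
      rw [hRdef, hU, rss, rss]
      simp only [Matrix.sub_mulVec, dotProduct_sub]
      ring
    obtain ⟨j, hj⟩ := hb (U / φ) ((l + R) / φ) (by positivity) (by positivity)
    rw [div_div_div_cancel_right₀ hφ.ne'] at hj
    have hpost := D.posterior_le ha hl hmc y
    rw [← hT, ← hR, hTU] at hpost
    have hpost0 := D.posterior_nonneg a l m y
    have hpost1 := D.posterior_le_one a l hmc y
    have hfit : 0 ≤ l + (R + U) + D.shrinkage y := by
      have h1 := D.fit_nonneg D.t_card y
      have h2 := D.fit_le y
      rw [← hT, hTU] at h2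
      linarith
    have hmain : D.posterior a l m y ≤ c * (1 + U / (l + R)) ^ (s' * ν / 2) := by
      rw [add_assoc] at hpost hfit
      rw [hTU] at hS
      exact le_of_le_odds ha hl he hn' hs hss hpost0 hpost1 hx₀0.le hR0 hU0 hS hW
        (by linarith) (by rwa [add_assoc])
    refine (ENNReal.ofReal_le_ofReal hmain).trans ?_
    rw [ENNReal.ofReal_mul hc0]
    gcongr
    refine le_trans ?_ (ENNReal.le_tsum j)
    have := hb0 j
    simp only [hF₂]
    rw [← ENNReal.ofReal_mul (by positivity)]
    refine ENNReal.ofReal_le_ofReal (hj.trans ?_)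
    have hexp : Real.exp (-(b j * ((l + R) / φ) / 2)) * Real.exp (s' * (U / φ) / 2) ≤
        Real.exp (1 * (ε ⬝ᵥ (Q j *ᵥ ε)) / (2 * φ)) := by
      rw [← Real.exp_add, Real.exp_le_exp, hQ, nestedForm_mulVec, zero_mul, zero_add, ← hU, ← hRdef]
      have h1 : b j * R / φ ≤ b j * ((l + R) / φ) := by
        rw [mul_div_assoc]
        gcongr
        linarith
      calc _ ≤ -(b j * R / φ / 2) + s' * (U / φ) / 2 := by gcongr
        _ = _ := by field_simp; ring
    calc _ = w j * (1 + b j) ^ (ν / 2) *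
          (Real.exp (-(b j * ((l + R) / φ) / 2)) * Real.exp (s' * (U / φ) / 2)) := by
          simp only [hw]; ring
      _ ≤ _ := by gcongr
  · have hsum : Measurable fun y => ∑' j, F₂ j y := Measurable.tsum hF₂m
    rw [lintegral_add_right _ (hsum.const_mul _), lintegral_add_right _ hF₁m,
      D.lintegral_shrinkageTail hφ, lintegral_const_mul (ENNReal.ofReal c) hsum,
      lintegral_tsum fun j => (hF₂m j).aemeasurable,
      ENNReal.ofReal_add (add_nonneg D.shrinkageProb_nonneg (by positivity)) (by positivity),
      ENNReal.ofReal_add D.shrinkageProb_nonneg (by positivity)]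
    have hint₁ : ∫⁻ y, F₁ y ∂(D.truth φ) = ENNReal.ofReal
        (Real.exp (n / 2) * (√((1 + e⁻¹)⁻¹ ^ D.t.card * (1 + e⁻¹) ^ n))⁻¹) := by
      have := inv_pos.2 he
      have hmeas : Measurable fun y => ENNReal.ofReal
          (Real.exp (-e⁻¹ * rss (cols D.X D.t) (y - D.mean) / (2 * φ))) :=
        measurable_exp_quadratic _ _ _ _
      rw [lintegral_const_mul _ hmeas, truth,
        lintegral_exp_rss hUt (by linarith) D.mean hφ, ENNReal.ofReal_mul (Real.exp_pos _).le,
        Fintype.card_coe, Fintype.card_fin, sub_neg_eq_add]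
    have hint₂ : ∀ j, ∫⁻ y, F₂ j y ∂(D.truth φ) = ENNReal.ofReal (w j) *
        ENNReal.ofReal (√((1 / (1 - s')) ^ D.t.card * (1 - s') ^ m.card))⁻¹ := by
      intro j
      have := lintegral_envelope hUt hUm hYX (hb0 j) hs'.2 D.mean hφ (Real.exp_pos _).le (w := w j)
      rw [Fintype.card_coe, Fintype.card_coe, Fintype.card_fin] at this
      exact this
    rw [hint₁]
    simp only [hint₂]
    rw [ENNReal.tsum_mul_right, tsum_envelope hs'.2, ENNReal.ofReal_mul hc0,
      ENNReal.ofReal_mul hB0]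

end Problem

/-! ### Non-spurious models at fixed sample size -/

theorem rss_add {ι κ : Type} [Fintype ι] [DecidableEq ι] [Fintype κ] [DecidableEq κ]
    (X : Matrix ι κ ℝ) (μ ε : ι → ℝ) :
    rss X (μ + ε) = rss X μ + 2 * (((1 - hat X) *ᵥ μ) ⬝ᵥ ε) + rss X ε := by
  have h : μ ⬝ᵥ ((1 - hat X) *ᵥ ε) = ((1 - hat X) *ᵥ μ) ⬝ᵥ ε := by
    rw [Matrix.dotProduct_mulVec, ← Matrix.mulVec_transpose, Matrix.transpose_sub,
      Matrix.transpose_one, hat_transpose]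
  simp only [rss, Matrix.mulVec_add, dotProduct_add, add_dotProduct, h]
  rw [dotProduct_comm ε ((1 - hat X) *ᵥ μ)]
  ring

/-- lam ≥ 80 lets one eighth of the gap absorb W ≤ 10φ, leaving lam·φ/2 between denominator and
numerator, while c is chosen so that the numerator is at most cNφ. -/
theorem le_of_le_odds_of_gap {a l φ c M N lam p x₀ S T W : ℝ} (ha : 0 < a)
    (hl : 0 < l) (hφ : 0 < φ) (hM : 0 < M) (hN : 1 ≤ N) (hc : c = l / φ + M + 10)
    (hlam : 80 ≤ lam) (hx₀ : 0 ≤ x₀) (hS : S ≤ M * N * φ) (hW : W ≤ 10 * φ)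
    (hT : S + 5 / 8 * lam * φ ≤ T) (hfit : 0 ≤ l + S + W)
    (hp : p ≤ x₀ * ((l + S + W) / (l + T)) ^ ((N + a) / 2)) :
    p ≤ x₀ * (1 + lam / (2 * c * N)) ^ (-(N / 2)) := by
  have hN0 : 0 < N := one_pos.trans_le hN
  have hc0 : 0 < c := by rw [hc]; positivity
  have hlam0 : 0 < lam := by linarith
  have hA : l + S + W ≤ c * N * φ := by
    have h1 : l ≤ l * N := le_mul_of_one_le_right hl.le hN
    have h2 : 10 * φ ≤ 10 * N * φ := by
      gcongr
      linarith
    have h3 : c * N * φ = l * N + M * N * φ + 10 * N * φ := by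
      rw [hc]; field_simp
    linarith
  have hden : l + S + W + lam * φ / 2 ≤ l + T := by
    have := mul_le_mul_of_nonneg_right hlam hφ.le
    linarith
  have hratio : (l + S + W) / (l + T) ≤ (1 + lam / (2 * c * N))⁻¹ := by
    have h1 : (1 + lam / (2 * c * N))⁻¹ = c * N * φ / (c * N * φ + lam * φ / 2) := by
      field_simp
    have h2 : 0 < lam * φ / 2 := by positivity
    rw [h1, div_le_div_iff₀ (by linarith) (by positivity)]
    calc (l + S + W) * (c * N * φ + lam * φ / 2) =
          (l + S + W) * (c * N * φ) + (l + S + W) * (lam * φ / 2) := by ring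
      _ ≤ (l + S + W) * (c * N * φ) + (c * N * φ) * (lam * φ / 2) := by gcongr
      _ = (c * N * φ) * (l + S + W + lam * φ / 2) := by ring
      _ ≤ c * N * φ * (l + T) := by gcongr
  have hbase : 1 ≤ 1 + lam / (2 * c * N) := le_add_of_nonneg_right (by positivity)
  have hr0 : 0 ≤ (l + S + W) / (l + T) :=
    div_nonneg hfit (by have : 0 < lam * φ / 2 := by positivity
                        linarith)
  refine hp.trans (mul_le_mul_of_nonneg_left ?_ hx₀)
  calc ((l + S + W) / (l + T)) ^ ((N + a) / 2) ≤
        (1 + lam / (2 * c * N))⁻¹ ^ ((N + a) / 2) := by gcongr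
    _ ≤ (1 + lam / (2 * c * N))⁻¹ ^ (N / 2) := by
      refine Real.rpow_le_rpow_of_exponent_ge (by positivity) (inv_le_one_of_one_le₀ hbase) ?_
      linarith
    _ = _ := by rw [Real.inv_rpow (by positivity), Real.rpow_neg (by positivity)]

namespace Problem

variable {n : ℕ} (D : Problem n)

theorem meanPosterior_nonSpurious_le {a l φ : ℝ} (ha : 0 < a) (hl : 0 < l) (hφ : 0 < φ)
    {m : Finset (Fin D.p)} (hm : D.NonSpurious m) (hn : 0 < n)
    (hlam₀ : D.t ≠ ∅ → D.lam φ ∅ ≤ D.tau * D.rhoMin) (hlam : 80 ≤ D.lam φ m) {M : ℝ}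
    (hM : 0 < M) :
    D.meanPosterior a l φ m ≤ D.shrinkageProb +
      Real.exp (-(M * n / 4)) * (√((1 - 1 / 2) ^ n))⁻¹ +
      Real.exp (-(D.lam φ m / 32)) * (√((1 - 1 / 2) ^ m.card))⁻¹ +
      Real.exp (-(D.lam φ m / 128)) +
      D.odds m * (D.rhoProd D.t / D.rhoProd m) *
        (1 + D.lam φ m / (2 * (l / φ + M + 10) * n)) ^ (-((n : ℝ) / 2)) := by
  have hmc := hm.2
  have hUt := D.isUnit_det_gram D.t_card
  have hUm := D.isUnit_det_gram hmc
  have hn' : (1 : ℝ) ≤ n := Nat.one_le_cast.2 hn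
  have hodds := D.odds_pos hmc
  have hrm := D.rhoProd_pos hmc
  have hrt := D.rhoProd_pos D.t_card
  have hlam0 : 0 < D.lam φ m := by linarith
  set x₀ := D.odds m * (D.rhoProd D.t / D.rhoProd m) with hx₀
  have hx₀0 : 0 < x₀ := by positivity
  set L := D.lam φ m with hL
  have hLφ : rss (cols D.X m) D.mean = L * φ := by
    rw [hL, lam_eq, div_mul_cancel₀ _ hφ.ne']
  set w := (1 - hat (cols D.X m)) *ᵥ D.mean with hw
  have hww : w ⬝ᵥ w = L * φ := by
    have h := one_sub_projection (hat_transpose (cols D.X m)) (hat_idem hUm)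
    rw [← hLφ, rss, dotProduct_projection h.1 h.2 D.mean]
  set v : Fin n → ℝ := (-(1 / (8 * φ))) • w with hv
  set F₁ := fun y : Fin n → ℝ => ENNReal.ofReal (Real.exp (-(M * n / 4))) *
    ENNReal.ofReal (Real.exp (1 / 2 * ((y - D.mean) ⬝ᵥ (y - D.mean)) / (2 * φ))) with hF₁
  set F₂ := fun y : Fin n → ℝ => ENNReal.ofReal (Real.exp (-(L / 32))) *
    ENNReal.ofReal (Real.exp (1 / 2 *
      ((y - D.mean) ⬝ᵥ (hat (cols D.X m) *ᵥ (y - D.mean))) / (2 * φ))) with hF₂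
  set F₃ := fun y : Fin n → ℝ => ENNReal.ofReal (Real.exp (-(L / 64))) *
    ENNReal.ofReal (Real.exp (v ⬝ᵥ (y - D.mean))) with hF₃
  have hG₁ : Measurable fun y : Fin n → ℝ =>
      ENNReal.ofReal (Real.exp (1 / 2 * ((y - D.mean) ⬝ᵥ (y - D.mean)) / (2 * φ))) := by
    simp only [dotProduct, Pi.sub_apply]
    fun_prop
  have hG₂ := measurable_exp_quadratic (hat (cols D.X m)) D.mean (1 / 2) (2 * φ)
  have hG₃ : Measurable fun y : Fin n → ℝ =>
      ENNReal.ofReal (Real.exp (v ⬝ᵥ (y - D.mean))) := by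
    simp only [dotProduct, Pi.sub_apply]
    fun_prop
  set X := x₀ * (1 + L / (2 * (l / φ + M + 10) * n)) ^ (-((n : ℝ) / 2)) with hX
  have hX0 : 0 ≤ X := by positivity
  have h₁ : 0 ≤ Real.exp (-(M * n / 4)) * (√((1 - 1 / 2) ^ n))⁻¹ := by positivity
  have h₂ : 0 ≤ Real.exp (-(L / 32)) * (√((1 - 1 / 2) ^ m.card))⁻¹ := by positivity
  have h₃ : 0 ≤ Real.exp (-(L / 128)) := by positivity
  have h₀ := D.shrinkageProb_nonneg
  refine D.meanPosterior_le_of_lintegral_le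
    (F := fun y => D.shrinkageTail φ y + F₁ y + F₂ y + F₃ y + ENNReal.ofReal X) ?_
    (by positivity) ?_
  · intro y
    have hp1 : ENNReal.ofReal (D.posterior a l m y) ≤ 1 := by
      rw [← ENNReal.ofReal_one]
      exact ENNReal.ofReal_le_ofReal (D.posterior_le_one a l hmc y)
    rcases lt_or_ge (10 * φ) (D.shrinkage y) with hW | hW
    · exact hp1.trans ((D.one_le_shrinkageTail hφ hlam₀ hW).trans
        (le_add_right (le_add_right (le_add_right (le_add_right le_rfl)))))
    have hT := rss_sub_of_hat_mulVec hUt (D.hat_mulVec_mean subset_rfl D.t_card) y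
    have hR := rss_add (cols D.X m) D.mean (y - D.mean)
    rw [add_sub_cancel, hLφ, ← hw] at hR
    simp only [hF₁, hF₂, hF₃]
    set ε := y - D.mean with hε
    have hTε : rss (cols D.X D.t) ε ≤ ε ⬝ᵥ ε := by
      have h := one_sub_projection (hat_transpose (cols D.X D.t)) (hat_idem hUt)
      exact projection_le h.1 h.2 ε
    have hRε : rss (cols D.X m) ε = ε ⬝ᵥ ε - ε ⬝ᵥ (hat (cols D.X m) *ᵥ ε) := by
      rw [rss, Matrix.sub_mulVec, Matrix.one_mulVec, dotProduct_sub]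
    rcases lt_or_ge (M * n * φ) (ε ⬝ᵥ ε) with h1 | h1
    · refine hp1.trans (le_add_right (le_add_right (le_add_right (le_add_left ?_))))
      rw [← ENNReal.ofReal_mul (Real.exp_pos _).le, ← Real.exp_add, ENNReal.one_le_ofReal,
        Real.one_le_exp_iff, ← sub_eq_neg_add, sub_nonneg, le_div_iff₀ (by positivity)]
      linarith
    rcases lt_or_ge (L * φ / 8) (ε ⬝ᵥ (hat (cols D.X m) *ᵥ ε)) with h2 | h2
    · refine hp1.trans (le_add_right (le_add_right (le_add_left ?_)))
      rw [← ENNReal.ofReal_mul (Real.exp_pos _).le, ← Real.exp_add, ENNReal.one_le_ofReal,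
        Real.one_le_exp_iff, ← sub_eq_neg_add, sub_nonneg, le_div_iff₀ (by positivity)]
      linarith
    rcases lt_or_ge (w ⬝ᵥ ε) (-(L * φ / 8)) with h3 | h3
    · refine hp1.trans (le_add_right (le_add_left ?_))
      rw [← ENNReal.ofReal_mul (Real.exp_pos _).le, ← Real.exp_add, ENNReal.one_le_ofReal,
        Real.one_le_exp_iff, ← sub_eq_neg_add, sub_nonneg, hv, smul_dotProduct, smul_eq_mul,
        neg_mul, one_div_mul_eq_div, ← neg_div, le_div_iff₀ (by positivity)]
      linarith
    refine le_add_left (ENNReal.ofReal_le_ofReal ?_)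
    have hpost := D.posterior_le ha hl hmc y
    have hfit : 0 ≤ l + rss (cols D.X D.t) y + D.shrinkage y := by
      have h1 := D.fit_nonneg D.t_card y
      have h2 := D.fit_le y
      linarith
    rw [← hT] at hpost hfit
    exact le_of_le_odds_of_gap ha hl hφ hM hn' rfl hlam hx₀0.le (hTε.trans h1) hW
      (by linarith) hfit hpost
  · have hi₁ : ∫⁻ y, F₁ y ∂(D.truth φ) =
        ENNReal.ofReal (Real.exp (-(M * n / 4)) * (√((1 - 1 / 2) ^ n))⁻¹) := by
      rw [lintegral_const_mul _ hG₁, truth, lintegral_exp_normSq (by norm_num) D.mean hφ,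
        ENNReal.ofReal_mul (Real.exp_pos _).le, Fintype.card_fin]
    have hi₂ : ∫⁻ y, F₂ y ∂(D.truth φ) =
        ENNReal.ofReal (Real.exp (-(L / 32)) * (√((1 - 1 / 2) ^ m.card))⁻¹) := by
      rw [lintegral_const_mul _ hG₂, truth, lintegral_exp_hat hUm (by norm_num) D.mean hφ,
        ENNReal.ofReal_mul (Real.exp_pos _).le, Fintype.card_coe]
    have hi₃ : ∫⁻ y, F₃ y ∂(D.truth φ) = ENNReal.ofReal (Real.exp (-(L / 128))) := by
      rw [lintegral_const_mul _ hG₃, truth, lintegral_exp_linear D.mean v hφ,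
        ← ENNReal.ofReal_mul (Real.exp_pos _).le, ← Real.exp_add, hv, smul_dotProduct,
        dotProduct_smul, hww]
      congr 2
      simp only [smul_eq_mul]
      field_simp
      ring
    have hp : (D.truth φ) univ = 1 := by
      rw [truth]
      exact measure_univ
    rw [lintegral_add_right _ measurable_const, lintegral_add_right _ (hG₃.const_mul _),
      lintegral_add_right _ (hG₂.const_mul _), lintegral_add_right _ (hG₁.const_mul _),
      D.lintegral_shrinkageTail hφ, lintegral_const, hp, mul_one,
      ENNReal.ofReal_add (by positivity) hX0, ENNReal.ofReal_add (by positivity) h₃,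
      ENNReal.ofReal_add (by positivity) h₂, ENNReal.ofReal_add h₀ h₁]
    exact (congrArg₂ _ (congrArg₂ _ (congrArg₂ _ (congrArg₂ _ rfl hi₁) hi₂) hi₃) rfl).le

end Problem

theorem inv_sqrt_pow_le {x : ℝ} (hx : 0 < x) (hx1 : x ≤ 1) (k : ℕ) :
    (√(x ^ k))⁻¹ ≤ x⁻¹ ^ k := by
  have h0 : 0 < x ^ k := pow_pos hx k
  have h1 : x ^ k ≤ 1 := pow_le_one₀ hx.le hx1
  rw [inv_pow]
  refine inv_anti₀ h0 (Real.le_sqrt_of_sq_le ?_)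
  rw [sq]
  exact mul_le_of_le_one_left h0.le h1

theorem inv_sqrt_half_pow_le (k : ℕ) : (√((1 - 1 / 2 : ℝ) ^ k))⁻¹ ≤ Real.exp k := by
  refine (inv_sqrt_pow_le (by norm_num) (by norm_num) k).trans ?_
  rw [← Real.exp_one_pow]
  have := Real.exp_one_gt_d9
  gcongr
  norm_num
  linarith

theorem exp_half_mul_inv_sqrt_le {K : ℝ} {p n : ℕ} (hp : 2 * p ≤ n) :
    Real.exp (n / 2) * (√((1 + (Real.exp (-K))⁻¹)⁻¹ ^ p * (1 + (Real.exp (-K))⁻¹) ^ n))⁻¹ ≤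
      Real.exp (n / 2 - K * n / 4) := by
  rw [← Real.exp_neg, neg_neg]
  set x := 1 + Real.exp K with hx
  have hx1 : 1 ≤ x := le_add_of_nonneg_right (Real.exp_pos _).le
  have hx0 : 0 < x := by positivity
  have h1 : Real.exp (K * n / 2) ≤ x⁻¹ ^ p * x ^ n := by
    have h2 : x⁻¹ ^ p * x ^ n = x ^ ((n : ℝ) - p) := by
      rw [Real.rpow_sub hx0, Real.rpow_natCast, Real.rpow_natCast, inv_pow, div_eq_inv_mul]
    have h3 : (2 : ℝ) * p ≤ n := by exact_mod_cast hp
    rw [h2]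
    calc Real.exp (K * n / 2) = Real.exp K ^ ((n : ℝ) / 2) := by
          rw [← Real.exp_mul, mul_div_assoc]
      _ ≤ x ^ ((n : ℝ) / 2) := by
          gcongr
          exact le_add_of_nonneg_left zero_le_one
      _ ≤ _ := Real.rpow_le_rpow_of_exponent_le hx1 (by linarith)
  have h4 : Real.exp (K * n / 4) ≤ √(x⁻¹ ^ p * x ^ n) := by
    refine Real.le_sqrt_of_sq_le (le_trans (le_of_eq ?_) h1)
    rw [← Real.exp_nat_mul]
    congr 1
    push_cast
    ring
  rw [Real.exp_sub, div_eq_mul_inv]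
  exact mul_le_mul_of_nonneg_left (inv_anti₀ (Real.exp_pos _) h4) (Real.exp_pos _).le

section Sequences

variable {D : (n : ℕ) → Problem n} {φ : ℝ}

theorem CondD2.eventually_lam_le (hD2 : CondD2 φ D) :
    ∀ᶠ n in atTop, (D n).t ≠ ∅ → (D n).lam φ ∅ ≤ (D n).tau * (D n).rhoMin := by
  filter_upwards [(isLittleO_iff.1 hD2) one_pos] with n hn ht
  have := mul_pos (D n).tau_pos ((D n).rhoMin_pos (Finset.nonempty_iff_ne_empty.2 ht))
  rw [one_mul, Real.norm_of_nonneg this.le] at hn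
  exact (le_abs_self _).trans hn

/-- The signal strength of a non-spurious model dominates the number of variables. -/
theorem CondB2.eventually_le_lam (hφ : 0 < φ) (hB2 : CondB2 φ D) (C : ℝ) :
    ∀ᶠ n in atTop, ∀ m, (D n).NonSpurious m →
      C * (((D n).t ∪ m).card : ℝ) ≤ (D n).lam φ m := by
  obtain ⟨β, hβ, h⟩ := hB2
  filter_upwards [h (max C 1) (by positivity)] with n hn m hm
  have hle := hn m hm
  have hlam := (D n).lam_nonneg hφ hm.2
  have hcard : (1 : ℝ) ≤ (((D n).t ∪ m).card : ℝ) := by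
    have : ((D n).t ∪ m).Nonempty := by
      obtain ⟨x, hx, -⟩ := Finset.not_subset.1 hm.1
      exact ⟨x, Finset.mem_union_left _ hx⟩
    exact_mod_cast this.card_pos
  have h1 : 1 ≤ (D n).lam φ m := by
    by_contra! hlt
    have h2 : (D n).lam φ m ^ β < 1 := Real.rpow_lt_one hlam hlt hβ.1
    have h3 : 1 * 1 ≤ max C 1 * (((D n).t ∪ m).card : ℝ) := by
      gcongr
      exact le_max_right _ _
    linarith
  calc C * (((D n).t ∪ m).card : ℝ) ≤ max C 1 * (((D n).t ∪ m).card : ℝ) := by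
        gcongr
        exact le_max_left _ _
    _ ≤ _ := hle
    _ ≤ (D n).lam φ m ^ (1 : ℝ) := Real.rpow_le_rpow_of_exponent_le h1 hβ.2.le
    _ = _ := Real.rpow_one _

theorem eventually_card_le (hφ : 0 < φ) (hB2 : CondB2 φ D) (hD2 : CondD2 φ D) (C : ℝ) :
    ∀ᶠ n in atTop, (D n).t ≠ ∅ → C * ((D n).t.card : ℝ) ≤ (D n).tau * (D n).rhoMin := by
  filter_upwards [hD2.eventually_lam_le, hB2.eventually_le_lam hφ C] with n h1 h2 ht
  have hns : (D n).NonSpurious ∅ := ⟨fun h => ht (Finset.subset_empty.1 h), Nat.zero_le _⟩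
  have h3 := h2 ∅ hns
  rw [Finset.union_empty] at h3
  exact h3.trans (h1 ht)

theorem eventually_shrinkageProb_le (hφ : 0 < φ) (hB2 : CondB2 φ D) (hD2 : CondD2 φ D) {c : ℝ}
    (hc : 0 < c) : ∀ᶠ n in atTop, (D n).shrinkageProb ≤ c * (D n).rhoTail := by
  filter_upwards [eventually_card_le hφ hB2 hD2 4,
    eventually_card_le hφ hB2 hD2 (4 * |Real.log c|)] with n h1 h2
  rw [Problem.shrinkageProb, Problem.rhoTail]
  split_ifs with ht
  · simp
  have h1 := h1 ht
  have h2 := h2 ht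
  have hcard : (1 : ℝ) ≤ ((D n).t.card : ℝ) := by
    exact_mod_cast (Finset.nonempty_iff_ne_empty.2 ht).card_pos
  set r := (D n).tau * (D n).rhoMin
  have h3 : -Real.log c ≤ |Real.log c| := neg_le_abs _
  have h4 : 4 * |Real.log c| * 1 ≤ 4 * |Real.log c| * ((D n).t.card : ℝ) := by gcongr
  calc Real.exp (-r) * (√((1 - 1 / 2) ^ (D n).t.card))⁻¹ ≤
        Real.exp (-r) * Real.exp ((D n).t.card) := by
        gcongr
        exact inv_sqrt_half_pow_le _
    _ = Real.exp (-r + (D n).t.card) := (Real.exp_add _ _).symm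
    _ ≤ Real.exp (Real.log c + -(r / 2)) := by
        rw [Real.exp_le_exp]
        linarith
    _ = _ := by rw [Real.exp_add, Real.exp_log hc]

theorem eventually_exp_neg_le {c : ℝ} (hc : 0 < c) : ∀ᶠ n : ℕ in atTop, Real.exp (-(n : ℝ)) ≤ c :=
  (Real.tendsto_exp_neg_atTop_nhds_zero.comp tendsto_natCast_atTop_atTop).eventually_le_const hc

theorem CondB1.eventually_pbar_le (hB1 : CondB1 D) {c : ℝ} (hc : 0 < c) :
    ∀ᶠ n in atTop, ((D n).pbar : ℝ) ≤ c * n := by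
  filter_upwards [(isLittleO_iff.1 hB1.1) hc] with n hn
  rw [Real.norm_of_nonneg (Nat.cast_nonneg _), Real.norm_of_nonneg (by positivity)] at hn
  exact hn.trans (by gcongr; exact min_le_left _ _)

theorem CondB1.eventually_le_tau (hB1 : CondB1 D) (C : ℝ) :
    ∀ᶠ n in atTop, 0 < (D n).pbar → C ≤ (D n).tau := by
  have hC : 0 < max C 1 := by positivity
  filter_upwards [(isLittleO_iff.1 hB1.2) (inv_pos.2 hC)] with n hn hp
  rw [Real.norm_of_nonneg (Nat.cast_nonneg _), Real.norm_of_nonneg (D n).tau_pos.le,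
    inv_mul_eq_div, le_div_iff₀ hC] at hn
  have h1 : (1 : ℝ) ≤ (D n).pbar := by exact_mod_cast hp
  calc C ≤ 1 * max C 1 := by rw [one_mul]; exact le_max_left _ _
    _ ≤ (D n).pbar * max C 1 := by gcongr
    _ ≤ _ := hn

theorem CondD1.exists_eventually_le {m : (n : ℕ) → Finset (Fin (D n).p)} (hD1 : CondD1 D m)
    (hm : ∀ᶠ n in atTop, (m n).card ≤ (D n).pbar) :
    ∃ c > (0 : ℝ), ∃ C > (0 : ℝ), ∀ᶠ n in atTop, (D n).rhoProd (D n).t / (D n).rhoProd (m n) ≤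
      C * (c * (D n).tau) ^ (-((D n).sizeDiff (m n) / 2)) := by
  obtain ⟨c, hc, h⟩ := hD1
  obtain ⟨C, hC, hle⟩ := h.2.exists_pos
  refine ⟨c, hc, C, hC, ?_⟩
  filter_upwards [hle.bound, hm] with n hn hmn
  have hrm := (D n).rhoProd_pos hmn
  have hrt := (D n).rhoProd_pos (D n).t_card
  have hτ := mul_pos hc (D n).tau_pos
  have hpow := Real.rpow_pos_of_pos hτ ((D n).sizeDiff (m n) / 2)
  rw [Real.norm_of_nonneg hpow.le, Real.norm_of_nonneg (by positivity)] at hn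
  rw [Real.rpow_neg hτ.le, ← div_eq_mul_inv, div_le_div_iff₀ hrm hpow]
  rw [← mul_div_assoc, le_div_iff₀ hrt] at hn
  linarith

end Sequences

theorem odds_mul_rpow_le {o r τ c C α β s : ℝ} {d : ℕ} (ho : 0 < o) (hr : 0 ≤ r) (hτ : 0 < τ)
    (hc : 0 < c) (hC : 0 < C) (hs : 0 < s) (hαs : α < s)
    (hrle : r ≤ C * (c * τ) ^ (-((d : ℝ) / 2))) (hole : o ≤ τ ^ (β * d / 2)) :
    (o * r) ^ s ≤ C ^ s * (o ^ α * τ ^ (α * (-(d : ℝ)) / 2)) *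
      (c ^ (-(s / 2)) * τ ^ (-((1 - β) * (s - α) / 2))) ^ d := by
  set z := o * τ ^ (-((d : ℝ) / 2)) with hz
  have hz0 : 0 < z := by positivity
  have h1 : o * r ≤ C * c ^ (-((d : ℝ) / 2)) * z := by
    calc o * r ≤ o * (C * (c * τ) ^ (-((d : ℝ) / 2))) := by gcongr
      _ = _ := by rw [Real.mul_rpow hc.le hτ.le, hz]; ring
  have h2 : z ≤ τ ^ (-((1 - β) * d / 2)) := by
    calc z ≤ τ ^ (β * d / 2) * τ ^ (-((d : ℝ) / 2)) := by rw [hz]; gcongr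
      _ = _ := by
        rw [← Real.rpow_add hτ]
        congr 1
        ring
  have h3 : z ^ (s - α) ≤ (τ ^ (-((1 - β) * (s - α) / 2))) ^ d := by
    calc z ^ (s - α) ≤ (τ ^ (-((1 - β) * d / 2))) ^ (s - α) :=
          Real.rpow_le_rpow hz0.le h2 (sub_pos.2 hαs).le
      _ = _ := by
        rw [← Real.rpow_mul hτ.le, ← Real.rpow_natCast, ← Real.rpow_mul hτ.le]
        congr 1
        ring
  have h4 : z ^ α = o ^ α * τ ^ (α * (-(d : ℝ)) / 2) := by
    rw [hz, Real.mul_rpow ho.le (by positivity), ← Real.rpow_mul hτ.le]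
    congr 2
    ring
  have h5 : (c ^ (-((d : ℝ) / 2))) ^ s = (c ^ (-(s / 2))) ^ d := by
    rw [← Real.rpow_mul hc.le, ← Real.rpow_natCast, ← Real.rpow_mul hc.le]
    congr 1
    ring
  calc (o * r) ^ s ≤ (C * c ^ (-((d : ℝ) / 2)) * z) ^ s := by gcongr
    _ = C ^ s * (c ^ (-(s / 2))) ^ d * (z ^ α * z ^ (s - α)) := by
      rw [← Real.rpow_add hz0, add_sub_cancel, Real.mul_rpow (by positivity) hz0.le,
        Real.mul_rpow hC.le (by positivity), h5]
    _ ≤ C ^ s * (c ^ (-(s / 2))) ^ d * (z ^ α * (τ ^ (-((1 - β) * (s - α) / 2))) ^ d) := by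
      gcongr
    _ = _ := by rw [h4, mul_pow]; ring

theorem isLittleO_meanPosterior_spurious {a l φ : ℝ} (ha : 0 < a) (hl : 0 < l) (hφ : 0 < φ)
    {D : (n : ℕ) → Problem n} (hB1 : CondB1 D) (hB2 : CondB2 φ D) (hD2 : CondD2 φ D)
    {m : (n : ℕ) → Finset (Fin (D n).p)} (hm : ∀ᶠ n in atTop, (D n).Spurious (m n))
    (hC1 : CondC1 D m) (hD1 : CondD1 D m) {α : ℝ} (hα : α ∈ Ioo (0 : ℝ) 1) (κ : ℝ) :
    (fun n => (D n).meanPosterior a l φ (m n)) =o[atTop] fun n =>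
      max (max ((D n).odds (m n) ^ α * (D n).tau ^ (α * (-(D n).sizeDiff (m n)) / 2))
        (Real.exp (-(κ * n)))) (D n).rhoTail := by
  obtain ⟨hα0, hα1⟩ := hα
  set s := (2 * α + 1) / 3 with hs
  set s' := (α + 2) / 3 with hs'
  have hs01 : s ∈ Ioo (0 : ℝ) 1 := ⟨by linarith, by linarith⟩
  have hs'01 : s' ∈ Ioo (0 : ℝ) 1 := ⟨by linarith, by linarith⟩
  have hαs : α < s := by linarith
  have hgap : 0 < s' - s := by linarith
  have h1s' : 0 < 1 - s' := by linarith
  obtain ⟨hτ, β, hβ, hodds⟩ := hC1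
  obtain ⟨c, hc, C, hC, hratio⟩ := hD1.exists_eventually_le (hm.mono fun n h => h.2)
  set γ := (1 - β) * (s - α) / 2 with hγ
  have hγ0 : 0 < γ := by
    have := sub_pos.2 hβ.2
    have := sub_pos.2 hαs
    positivity
  set K := 4 * κ + 6 with hK
  set e := Real.exp (-K) with he
  have he0 : 0 < e := Real.exp_pos _
  set B := C ^ s * Real.exp (5 * (1 + a) / e) * (envelopeConst s' + 1) with hB
  have henv := envelopeConst_nonneg hs'01.2
  have hB0 : 0 < B := by positivity
  set A := c ^ (-(s / 2)) * (1 - s')⁻¹ with hA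
  have hA0 : 0 < A := by positivity
  rw [isLittleO_iff]
  intro η hη
  have hτγ : Tendsto (fun n => A * (D n).tau ^ (-γ)) atTop (nhds 0) := by
    have := ((tendsto_rpow_neg_atTop hγ0).comp hτ).const_mul A
    simpa using this
  have hδ : 0 < min 1 (η / 3 / B) := by positivity
  filter_upwards [hm, hratio, (isLittleO_iff.1 hodds) one_pos, hτγ.eventually_le_const hδ,
    hB1.eventually_pbar_le (c := (s' - s) / 2) (by positivity),
    tendsto_natCast_atTop_atTop.eventually_ge_atTop (a / ((s' - s) / 2)),
    eventually_exp_neg_le (c := η / 3) (by positivity), eventually_ge_atTop 1,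
    eventually_shrinkageProb_le hφ hB2 hD2 (c := η / 3) (by positivity), hD2.eventually_lam_le]
    with n hmn hratio hodds hAτ hpbar hna hexp hn1 hshr hlam
  have hn0 : (0 : ℝ) < n := by exact_mod_cast hn1
  have hτ0 := (D n).tau_pos
  have hmc := hmn.2
  have hmcard : ((m n).card : ℝ) ≤ (s' - s) / 2 * n := (Nat.cast_le.2 hmc).trans hpbar
  have htcard : (((D n).t).card : ℝ) ≤ (s' - s) / 2 * n := (Nat.cast_le.2 (D n).t_card).trans hpbar
  have hsmall : (s' - s) / 2 ≤ 1 / 2 := by linarith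
  have hmlt : (m n).card < n := by
    have : ((m n).card : ℝ) < n := by nlinarith
    exact_mod_cast this
  have h2t : 2 * (D n).t.card ≤ n := by
    have : 2 * ((D n).t.card : ℝ) ≤ n := by nlinarith
    exact_mod_cast this
  rw [div_le_iff₀ (by positivity)] at hna
  have hss : s * (n + a) ≤ s' * (n - (m n).card) := by
    have h1 : s * a ≤ 1 * a := by gcongr; exact hs01.2.le
    have h2 : s' * ((m n).card : ℝ) ≤ 1 * ((m n).card : ℝ) := by gcongr; exact hs'01.2.le
    linarith
  have hbound := (D n).meanPosterior_spurious_le ha hl hφ hmn hn1 hlam he0 hs01 hs'01 hmlt hss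
  obtain ⟨d, hd⟩ := Nat.exists_eq_add_of_lt (Finset.card_lt_card hmn.1)
  have hsd : (D n).sizeDiff (m n) = ((d + 1 : ℕ) : ℝ) := by
    rw [Problem.sizeDiff, hd]
    push_cast
    ring
  rw [hsd] at hratio hodds ⊢
  have ho := (D n).odds_pos hmc
  have hrm := (D n).rhoProd_pos hmc
  have hrt := (D n).rhoProd_pos (D n).t_card
  rw [Real.norm_of_nonneg ho.le, Real.norm_of_nonneg (by positivity), one_mul] at hodds
  have hpow := odds_mul_rpow_le ho (div_nonneg hrt.le hrm.le) hτ0 hc hC hs01.1 hαs hratio hodds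
  set T := (D n).odds (m n) ^ α * (D n).tau ^ (α * (-((d + 1 : ℕ) : ℝ)) / 2) with hT
  have hT0 : 0 ≤ T := by positivity
  have hbeta : (√((1 / (1 - s')) ^ (D n).t.card * (1 - s') ^ (m n).card))⁻¹ ≤
      (1 - s')⁻¹ ^ (d + 1) := by
    have : (1 / (1 - s')) ^ (D n).t.card * (1 - s') ^ (m n).card = (1 - s') ^ (d + 1) := by
      rw [hd, add_assoc, pow_add, ← mul_assoc, ← mul_pow, one_div_mul_cancel h1s'.ne', one_pow,
        one_mul]
    rw [this]
    exact inv_sqrt_pow_le h1s' (by linarith [hs'01.1]) _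
  have hmain : ((D n).odds (m n) * ((D n).rhoProd (D n).t / (D n).rhoProd (m n))) ^ s *
      Real.exp (5 * (1 + a) / e) * (envelopeConst s' *
        (√((1 / (1 - s')) ^ (D n).t.card * (1 - s') ^ (m n).card))⁻¹) ≤ η / 3 * T := by
    calc _ ≤ C ^ s * T * (c ^ (-(s / 2)) * (D n).tau ^ (-γ)) ^ (d + 1) *
          Real.exp (5 * (1 + a) / e) * ((envelopeConst s' + 1) * (1 - s')⁻¹ ^ (d + 1)) := by
          gcongr
          linarith
      _ = B * T * (A * (D n).tau ^ (-γ)) ^ (d + 1) := by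
          rw [hB, hA]
          ring
      _ ≤ B * T * (η / 3 / B) := by
          gcongr
          have h0 : 0 ≤ A * (D n).tau ^ (-γ) := by positivity
          calc (A * (D n).tau ^ (-γ)) ^ (d + 1) ≤ A * (D n).tau ^ (-γ) :=
                pow_le_of_le_one h0 (hAτ.trans (min_le_left _ _)) (Nat.succ_ne_zero d)
            _ ≤ _ := hAτ.trans (min_le_right _ _)
      _ = η / 3 * T := by field_simp
  have hlow : Real.exp (n / 2) * (√((1 + e⁻¹)⁻¹ ^ (D n).t.card * (1 + e⁻¹) ^ n))⁻¹ ≤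
      η / 3 * Real.exp (-(κ * n)) := by
    refine (exp_half_mul_inv_sqrt_le h2t).trans ?_
    calc Real.exp (n / 2 - K * n / 4) = Real.exp (-(n : ℝ)) * Real.exp (-(κ * n)) := by
          rw [← Real.exp_add, hK]
          congr 1
          ring
      _ ≤ _ := by gcongr
  have hmax0 : 0 ≤ max (max T (Real.exp (-(κ * n)))) (D n).rhoTail :=
    hT0.trans ((le_max_left _ _).trans (le_max_left _ _))
  rw [Real.norm_of_nonneg ((D n).meanPosterior_nonneg a l φ (m n)), Real.norm_of_nonneg hmax0]
  calc _ ≤ _ := hbound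
    _ ≤ η / 3 * (D n).rhoTail + η / 3 * Real.exp (-(κ * n)) + η / 3 * T := by gcongr
    _ ≤ η / 3 * max (max T (Real.exp (-(κ * n)))) (D n).rhoTail +
        η / 3 * max (max T (Real.exp (-(κ * n)))) (D n).rhoTail +
        η / 3 * max (max T (Real.exp (-(κ * n)))) (D n).rhoTail := by
      gcongr
      · exact le_max_right _ _
      · exact (le_max_right _ _).trans (le_max_left _ _)
      · exact (le_max_left _ _).trans (le_max_left _ _)
    _ = _ := by ring

theorem odds_mul_le_exp {o r τ c C δ q : ℝ} (ho : 0 < o) (hc : 0 < c) (hC : 0 < C)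
    (hτ : Real.exp (4 * |Real.log c| + 4) ≤ τ) (hq : 0 ≤ q)
    (hr : r ≤ C * (c * τ) ^ (-(δ / 2))) (hpos : 0 < q + δ * Real.log (1 + τ))
    (hlog : Real.log o ≤ 1 / 4 * (q + δ * Real.log (1 + τ))) :
    o * r ≤ C * Real.exp (2 * q) := by
  have hτ0 : 0 < τ := (Real.exp_pos _).trans_le hτ
  have hlogτ : 4 * |Real.log c| + 4 ≤ Real.log τ := (Real.le_log_iff_exp_le hτ0).2 hτ
  have hτ1 : 1 ≤ τ := (Real.one_le_exp (by positivity)).trans hτ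
  have hub : Real.log (1 + τ) ≤ 1 + Real.log τ := by
    calc Real.log (1 + τ) ≤ Real.log (Real.exp 1 * τ) := by
          refine Real.log_le_log (by positivity) ?_
          have := Real.add_one_le_exp 1
          nlinarith
      _ = _ := by rw [Real.log_mul (Real.exp_pos _).ne' hτ0.ne', Real.log_exp]
  have hlb : Real.log τ ≤ Real.log (1 + τ) := Real.log_le_log hτ0 (by linarith)
  have hc1 := le_abs_self (Real.log c)
  have hc2 := neg_le_abs (Real.log c)
  have hc3 := abs_nonneg (Real.log c)
  have key : Real.log o - δ / 2 * (Real.log c + Real.log τ) ≤ 2 * q := by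
    rcases le_or_gt 0 δ with hδ | hδ
    · have h1 : δ * (1 / 4 * Real.log (1 + τ) - 1 / 2 * (Real.log c + Real.log τ)) ≤ 0 :=
        mul_nonpos_of_nonneg_of_nonpos hδ (by linarith)
      linarith
    · have h1 : 0 ≤ (-δ) * (Real.log (1 + τ) - 1 / 2 * (Real.log c + Real.log τ)) :=
        mul_nonneg (by linarith) (by linarith)
      have h2 : 0 ≤ (-δ) * Real.log (1 + τ) := mul_nonneg (by linarith) (by linarith)
      linarith
  calc o * r ≤ o * (C * (c * τ) ^ (-(δ / 2))) := by gcongr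
    _ = C * Real.exp (Real.log o - δ / 2 * (Real.log c + Real.log τ)) := by
      rw [Real.rpow_def_of_pos (by positivity), Real.log_mul hc.ne' hτ0.ne', sub_eq_add_neg,
        Real.exp_add, Real.exp_log ho]
      ring_nf
    _ ≤ _ := by gcongr

/-- The decay of the likelihood ratio against a non-spurious model, both for weak and for strong
signals. -/
theorem exp_mul_one_add_rpow_le {N lam c L q g C κ v η : ℝ} (hN : 0 < N) (hlam : 0 < lam)
    (hc : 0 < c) (hL : 0 < L) (hC : 0 ≤ C) (hκL : 2 * (κ + 2) ≤ Real.log (1 + L / c))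
    (hg : g = 1 / (2 * c * (1 + L / c))) (hqN : 2 * q ≤ N) (hqlam : 2 * q + v ≤ g * lam / 2)
    (hη1 : C * Real.exp (-N) ≤ η) (hη2 : C * Real.exp (-(g * lam / 2)) ≤ η) :
    C * Real.exp (2 * q) * (1 + lam / (c * N)) ^ (-(N / 2)) ≤
      η * Real.exp (-(min v (κ * N))) := by
  have hbase : 0 < 1 + lam / (c * N) := by positivity
  have hη : 0 ≤ η := le_trans (by positivity) hη1
  rw [Real.rpow_def_of_pos hbase, mul_assoc, ← Real.exp_add]
  rcases le_or_gt lam (L * N) with hle | hgt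
  · have hlog : lam / (c * N) / (1 + L / c) ≤ Real.log (1 + lam / (c * N)) := by
      have h1 := Real.one_sub_inv_le_log_of_pos hbase
      have h2 : 1 - (1 + lam / (c * N))⁻¹ = lam / (c * N) / (1 + lam / (c * N)) := by
        field_simp
        ring
      rw [h2] at h1
      refine le_trans ?_ h1
      refine div_le_div_of_nonneg_left (by positivity) (by positivity) ?_
      gcongr 1 + ?_
      rw [div_le_div_iff₀ (by positivity) hc]
      nlinarith
    have hglam : g * lam ≤ Real.log (1 + lam / (c * N)) * (N / 2) := by
      have : g * lam = lam / (c * N) / (1 + L / c) * (N / 2) := by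
        rw [hg]
        field_simp
      rw [this]
      gcongr
    calc C * Real.exp (2 * q + Real.log (1 + lam / (c * N)) * -(N / 2)) ≤
          C * Real.exp (-(g * lam / 2) + -v) :=
          mul_le_mul_of_nonneg_left (Real.exp_le_exp.2 (by linarith)) hC
      _ = C * Real.exp (-(g * lam / 2)) * Real.exp (-v) := by rw [Real.exp_add, mul_assoc]
      _ ≤ _ := by
        gcongr
        exact min_le_left _ _
  · have hlog : 2 * (κ + 2) ≤ Real.log (1 + lam / (c * N)) := by
      refine hκL.trans (Real.log_le_log (by positivity) ?_)
      gcongr 1 + ?_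
      rw [div_le_div_iff₀ hc (by positivity)]
      nlinarith
    have hlogN : 2 * (κ + 2) * (N / 2) ≤ Real.log (1 + lam / (c * N)) * (N / 2) := by gcongr
    calc C * Real.exp (2 * q + Real.log (1 + lam / (c * N)) * -(N / 2)) ≤
          C * Real.exp (-N + -(κ * N)) :=
          mul_le_mul_of_nonneg_left (Real.exp_le_exp.2 (by linarith)) hC
      _ = C * Real.exp (-N) * Real.exp (-(κ * N)) := by rw [Real.exp_add, mul_assoc]
      _ ≤ _ := by
        gcongr
        exact min_le_right _ _

theorem eventually_rpow_le {b c : ℝ} (hb : b < 1) (hc : 0 < c) :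
    ∃ B : ℝ, ∀ x, B ≤ x → x ^ b ≤ c * x := by
  obtain ⟨B, hB⟩ := eventually_atTop.1
    (((tendsto_rpow_neg_atTop (sub_pos.2 hb)).eventually_le_const hc).and (eventually_gt_atTop 0))
  refine ⟨B, fun x hx => ?_⟩
  obtain ⟨h1, h2⟩ := hB x hx
  calc x ^ b = x ^ (-(1 - b)) * x := by rw [← Real.rpow_add_one h2.ne']; ring_nf
    _ ≤ c * x := by gcongr

theorem PolySignal.eventually_rpow_le {φ : ℝ} (hφ : 0 < φ) {D : (n : ℕ) → Problem n}
    {m : (n : ℕ) → Finset (Fin (D n).p)} (hm : ∀ᶠ n in atTop, (m n).card ≤ (D n).pbar)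
    (h : PolySignal φ D m) :
    ∃ b ∈ Ioo (0 : ℝ) 1, ∀ c > (0 : ℝ), ∀ᶠ n : ℕ in atTop, (D n).lam φ (m n) ^ b ≤ c * n := by
  obtain ⟨K, hK⟩ := h
  obtain ⟨C, hC, hle⟩ := hK.exists_pos
  have hK1 : (0 : ℝ) < K + 1 := by positivity
  have hb0 : 0 < 1 / (2 * ((K : ℝ) + 1)) := by positivity
  refine ⟨1 / (2 * ((K : ℝ) + 1)), ⟨hb0, ?_⟩, fun c hc => ?_⟩
  · rw [div_lt_one (by positivity)]
    have : (0 : ℝ) ≤ K := Nat.cast_nonneg K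
    linarith
  set b := 1 / (2 * ((K : ℝ) + 1)) with hb
  have hKb : K * b ≤ 1 / 2 := by
    rw [hb, mul_one_div, div_le_div_iff₀ (by positivity) two_pos]
    linarith
  obtain ⟨B, hB⟩ := BMS.eventually_rpow_le (b := 1 / 2) (c := c / C ^ b) (by norm_num)
    (by positivity)
  filter_upwards [hle.bound, hm, tendsto_natCast_atTop_atTop.eventually_ge_atTop B,
    eventually_ge_atTop 1] with n hn hmn hBn hn1
  have hn1' : (1 : ℝ) ≤ n := by exact_mod_cast hn1
  have hlam := (D n).lam_nonneg hφ hmn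
  rw [Real.norm_of_nonneg hlam, Real.norm_of_nonneg (by positivity)] at hn
  calc (D n).lam φ (m n) ^ b ≤ (C * (n : ℝ) ^ K) ^ b := by gcongr
    _ = C ^ b * (n : ℝ) ^ (K * b) := by
      rw [Real.mul_rpow hC.le (by positivity), Real.rpow_natCast_mul (by positivity)]
    _ ≤ C ^ b * (n : ℝ) ^ (1 / 2 : ℝ) := by gcongr
    _ ≤ C ^ b * (c / C ^ b * n) := by gcongr; exact hB _ hBn
    _ = c * n := by field_simp

theorem isLittleO_meanPosterior_nonSpurious {a l φ : ℝ} (ha : 0 < a) (hl : 0 < l) (hφ : 0 < φ)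
    {D : (n : ℕ) → Problem n} (hB1 : CondB1 D) (hB2 : CondB2 φ D) (hD2 : CondD2 φ D)
    {m : (n : ℕ) → Finset (Fin (D n).p)} (hm : ∀ᶠ n in atTop, (D n).NonSpurious (m n))
    (hC2 : CondC2 φ D m) (hD1 : CondD1 D m) (hS : PolySignal φ D m) {γ : ℝ} (hγ : 0 ≤ γ) {α : ℝ}
    (hα : α < 1) {κ : ℝ} (hκ : 0 < κ) :
    (fun n => (D n).meanPosterior a l φ (m n)) =o[atTop] fun n =>
      Real.exp (-(min (min (γ * (D n).lam φ (m n) ^ α / 2) (κ * n))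
        ((D n).tau * (D n).rhoMin / 2))) := by
  have hmc : ∀ᶠ n in atTop, (m n).card ≤ (D n).pbar := hm.mono fun n h => h.2
  obtain ⟨b, hb, hbn⟩ := hS.eventually_rpow_le hφ hmc
  obtain ⟨hpos, hlog⟩ := hC2 b hb
  obtain ⟨c, hc, C, hC, hratio⟩ := hD1.exists_eventually_le hmc
  set M := 4 * (κ + 2) with hM
  have hM0 : 0 < M := by positivity
  set c₂ := 2 * (l / φ + M + 10) with hc₂
  have hc₂0 : 0 < c₂ := by positivity
  set L := c₂ * Real.exp (2 * (κ + 2)) with hL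
  have hL0 : 0 < L := by positivity
  have hκL : 2 * (κ + 2) ≤ Real.log (1 + L / c₂) := by
    rw [Real.le_log_iff_exp_le (by positivity), hL, mul_div_cancel_left₀ _ hc₂0.ne']
    linarith
  set g := 1 / (2 * c₂ * (1 + L / c₂)) with hg
  have hg0 : 0 < g := by positivity
  rw [isLittleO_iff]
  intro η hη
  have hη5 : 0 < η / 5 := by positivity
  obtain ⟨B₁, hB₁⟩ := eventually_rpow_le (b := b) (c := g / 8) hb.2 (by positivity)
  obtain ⟨B₂, hB₂⟩ := eventually_rpow_le (b := α) (c := g / (4 * (γ + 1))) hα (by positivity)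
  obtain ⟨B₃, hB₃⟩ := eventually_rpow_le (b := α) (c := 1 / (256 * (γ + 1))) hα (by positivity)
  obtain ⟨B₄, hB₄⟩ := eventually_atTop.1 (((Real.tendsto_exp_neg_atTop_nhds_zero.comp
    (tendsto_id.const_mul_atTop (half_pos hg0))).const_mul C).eventually_le_const
      (show C * 0 < η / 5 by rwa [mul_zero]))
  obtain ⟨B₅, hB₅⟩ := eventually_atTop.1 ((Real.tendsto_exp_neg_atTop_nhds_zero.comp
    (tendsto_id.const_mul_atTop (show (0 : ℝ) < 1 / 256 by norm_num))).eventually_le_const hη5)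
  set B := max (max (max (max (max B₁ B₂) B₃) B₄) B₅) 80 with hB
  filter_upwards [hm, hpos, hlog (1 / 4) (by norm_num), hratio, hbn (1 / 2) (by norm_num),
    eventually_exp_neg_le hη5, eventually_exp_neg_le (c := η / 5 / C) (by positivity),
    eventually_ge_atTop 1, eventually_shrinkageProb_le hφ hB2 hD2 hη5, hD2.eventually_lam_le,
    hB1.eventually_le_tau (Real.exp (4 * |Real.log c| + 4)), hB2.eventually_le_lam hφ |B|,
    hB2.eventually_le_lam hφ 64]
    with n hmn hpos hlog hratio hbn hexp hexpC hn1 hshr hlam₀ hτ hBlam h64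
  have hn0 : (0 : ℝ) < n := by exact_mod_cast hn1
  have hBlam := hBlam _ hmn
  have h64 := h64 _ hmn
  have htne : (D n).t ≠ ∅ := fun h => hmn.1 (h ▸ Finset.empty_subset _)
  have hunion : (1 : ℝ) ≤ (((D n).t ∪ m n).card : ℝ) := by
    have : ((D n).t ∪ m n).Nonempty :=
      (Finset.nonempty_iff_ne_empty.2 htne).mono Finset.subset_union_left
    exact_mod_cast this.card_pos
  have hBle : B ≤ (D n).lam φ (m n) := by
    refine le_trans ?_ hBlam
    calc B ≤ |B| * 1 := by rw [mul_one]; exact le_abs_self B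
      _ ≤ _ := by gcongr
  have hmle : ((m n).card : ℝ) ≤ (((D n).t ∪ m n).card : ℝ) := by
    exact_mod_cast Finset.card_le_card Finset.subset_union_right
  have hτ := hτ ((Finset.nonempty_iff_ne_empty.2 htne).card_pos.trans_le (D n).t_card)
  set lam := (D n).lam φ (m n) with hlamdef
  simp only [hB, max_le_iff] at hBle
  obtain ⟨⟨⟨⟨⟨h1, h2⟩, h3⟩, h4⟩, h5⟩, h80⟩ := hBle
  have hlam0 : 0 < lam := by linarith
  have h1 := hB₁ _ h1
  have h2 := hB₂ _ h2
  have h3 := hB₃ _ h3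
  have h4 : C * Real.exp (-(g / 2 * lam)) ≤ η / 5 := hB₄ _ h4
  have h5 : Real.exp (-(1 / 256 * lam)) ≤ η / 5 := hB₅ _ h5
  set v := γ * lam ^ α / 2 with hv
  have hv2 : v ≤ g * lam / 8 := by
    calc v ≤ (γ + 1) * (g / (4 * (γ + 1)) * lam) / 2 := by
          rw [hv]
          gcongr
          linarith
      _ = _ := by field_simp; ring
  have hv3 : v ≤ lam / 256 := by
    calc v ≤ (γ + 1) * (1 / (256 * (γ + 1)) * lam) / 2 := by
          rw [hv]
          gcongr
          linarith
      _ = lam / 512 := by field_simp; ring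
      _ ≤ _ := by linarith
  set T := Real.exp (-(min (min v (κ * n)) ((D n).tau * (D n).rhoMin / 2))) with hT
  have hT1 : Real.exp (-(min v (κ * n))) ≤ T :=
    Real.exp_le_exp.2 (neg_le_neg (min_le_left _ _))
  have hTv : Real.exp (-v) ≤ T :=
    (Real.exp_le_exp.2 (neg_le_neg (min_le_left _ _))).trans hT1
  have hTκ : Real.exp (-(κ * n)) ≤ T :=
    (Real.exp_le_exp.2 (neg_le_neg (min_le_right _ _))).trans hT1
  have hTτ : (D n).rhoTail ≤ T := by
    rw [Problem.rhoTail, if_neg htne, hT]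
    gcongr
    exact min_le_right _ _
  have hbound := (D n).meanPosterior_nonSpurious_le ha hl hφ hmn hn1 hlam₀ h80 hM0
  rw [← hc₂] at hbound
  have e₁ : Real.exp (-(M * n / 4)) * (√((1 - 1 / 2) ^ n))⁻¹ ≤ η / 5 * T := by
    calc _ ≤ Real.exp (-(M * n / 4)) * Real.exp n := by
          gcongr
          exact inv_sqrt_half_pow_le n
      _ = Real.exp (-(n : ℝ)) * Real.exp (-(κ * n)) := by
          rw [← Real.exp_add, ← Real.exp_add, hM]
          congr 1
          ring
      _ ≤ _ := by gcongr
  have e₀ : Real.exp (-(lam / 128)) ≤ η / 5 * T := by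
    calc Real.exp (-(lam / 128)) ≤ Real.exp (-(1 / 256 * lam)) * Real.exp (-v) := by
          rw [← Real.exp_add, Real.exp_le_exp]
          linarith
      _ ≤ _ := by gcongr
  have e₂ : Real.exp (-(lam / 32)) * (√((1 - 1 / 2) ^ (m n).card))⁻¹ ≤ η / 5 * T := by
    calc _ ≤ Real.exp (-(lam / 32)) * Real.exp (m n).card := by
          gcongr
          exact inv_sqrt_half_pow_le _
      _ ≤ Real.exp (-(lam / 128)) := by
          rw [← Real.exp_add, Real.exp_le_exp]
          linarith
      _ ≤ _ := e₀
  have e₃ : (D n).odds (m n) * ((D n).rhoProd (D n).t / (D n).rhoProd (m n)) *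
      (1 + lam / (c₂ * n)) ^ (-((n : ℝ) / 2)) ≤ η / 5 * T := by
    have hglam : 0 < g * lam := by positivity
    have hodds := odds_mul_le_exp ((D n).odds_pos hmn.2) hc hC hτ (by positivity) hratio hpos hlog
    have hdecay := exp_mul_one_add_rpow_le (N := n) (lam := lam) (q := lam ^ b) (v := v) (κ := κ)
      (η := η / 5) hn0 hlam0 hc₂0 hL0 hC.le hκL hg (by linarith) (by linarith)
      (by rw [le_div_iff₀ hC] at hexpC; linarith) (by convert! h4 using 3; ring)
    calc _ ≤ C * Real.exp (2 * lam ^ b) * (1 + lam / (c₂ * n)) ^ (-((n : ℝ) / 2)) := by gcongr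
      _ ≤ _ := hdecay
      _ ≤ _ := by gcongr
  rw [Real.norm_of_nonneg ((D n).meanPosterior_nonneg a l φ (m n)),
    Real.norm_of_nonneg (Real.exp_pos _).le]
  calc _ ≤ _ := hbound
    _ ≤ η / 5 * T + η / 5 * T + η / 5 * T + η / 5 * T + η / 5 * T := by
      gcongr
      exact hshr.trans (by gcongr)
    _ = _ := by ring

end BMS

end

theorem proposition4 (a l φ : ℝ) (ha : 0 < a) (hl : 0 < l) (hφ : 0 < φ)
    (D : (n : ℕ) → BMS.Problem n)
    (hB1 : BMS.CondB1 D) (hB2 : BMS.CondB2 φ D) (hD2 : BMS.CondD2 φ D) :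
    (∀ m : (n : ℕ) → Finset (Fin (D n).p),
      (∀ᶠ n in atTop, (D n).Spurious (m n)) → BMS.CondC1 D m → BMS.CondD1 D m →
      ∀ α ∈ Ioo (0 : ℝ) 1, ∀ κ > (0 : ℝ),
        (fun n => (D n).meanPosterior a l φ (m n)) =o[atTop] fun n =>
          max (max ((D n).odds (m n) ^ α * (D n).tau ^ (α * (-(D n).sizeDiff (m n)) / 2))
            (Real.exp (-(κ * n)))) (D n).rhoTail) ∧
    (∀ m : (n : ℕ) → Finset (Fin (D n).p),
      (∀ᶠ n in atTop, (D n).NonSpurious (m n)) → BMS.CondC2 φ D m → BMS.CondD1 D m →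
      BMS.PolySignal φ D m →
      ∀ γ ∈ Ioo (0 : ℝ) 1, ∀ α ∈ Ioo (0 : ℝ) 1, ∀ κ > (0 : ℝ),
        (fun n => (D n).meanPosterior a l φ (m n)) =o[atTop] fun n =>
          Real.exp (-(min (min (γ * (D n).lam φ (m n) ^ α / 2) (κ * n))
            ((D n).tau * (D n).rhoMin / 2)))) := by
  refine ⟨fun m hm hC1 hD1 α hα κ _ => ?_, fun m hm hC2 hD1 hS γ hγ α hα κ hκ => ?_⟩
  · exact BMS.isLittleO_meanPosterior_spurious ha hl hφ hB1 hB2 hD2 hm hC1 hD1 hα κ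
  · exact BMS.isLittleO_meanPosterior_nonSpurious ha hl hφ hB1 hB2 hD2 hm hC2 hD1 hS hγ.1.le hα.2 hκ
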